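/- **Theorem 3.1.** Let $l$ be a positive integer. Let $\mathfrak S_{2l}$ be the symmetric group on $\{1,\dots,2l\}$, arranged as the standard tableau with rows $(1,\dots,l)$ and $(l+1,\dots,2l)$; let $K\cong\mathfrak S_l\times\mathfrak S_l$ be its row group and $H\cong\mathfrak S_2^{\,l}$ its column group. For a permutation $\sigma$ with $m_i(\sigma)$ cycles of length $i$ put $\nu(\sigma)=\sum_{i\ge1}(i-1)m_i(\sigma)$. For $0\le p\le l$ let $\lambda=(2l-p,p)$, let $\mathcal S^\lambda$ be the irreducible unitary (right) $\mathfrak S_{2l}$-module attached to $\lambda$, with character $\chi^\lambda$, let $e_1,\dots,e_d$ be any orthonormal basis of the space of $K$-invariants of $\mathcal S^\lambda$, and define for $\alpha\in\mathbb C$ $$F^{\lambda}_{2,l}(\alpha)=\Bigl(\sum_{h\in H}\alpha^{\nu(h)}\langle e_i\cdot h,e_j\rangle\Bigr)_{1\le i,j\le d},\qquad \omega^\lambda(g)=\frac1{|K|}\sum_{k\in K}\chi^\lambda(kg)\quad(g\in\mathfrak S_{2l}).$$ Write $(a)_j=a(a+1)\cdots(a+j-1)$ and let $$Q_p(x;a,b,N)=\sum_{j=0}^{N}\frac{(-p)_j\,(p+a+b+1)_j\,(-x)_j}{(a+1)_j\,(-N)_j\,j!},\qquad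 G_p^l(x)=\sum_{j=0}^{l}\frac{(-p)_j\,(l-p+1)_j}{(-l)_j}\,\frac{(-x)^j}{j!}$$ be the Hahn polynomial ${}_3F_2(-p,p+a+b+1,-x;a+1,-N;1)$ and the terminating ${}_2F_1(-p,l-p+1;-l;-x)$. Then for every $p=0,1,\dots,l$: 1. $d=1$, so that $F^\lambda_{2,l}(\alpha)$ is a single polynomial in $\alpha$. 2. $\omega^{\lambda}(g_s)=Q_p(s;-l-1,-l-1,l)$ for $0\le s\le l$, where $g_s=(1,l+1)(2,l+2)\cdots(s,l+s)$. 3. For all $\alpha\in\mathbb C$, $$F^{(2l-p,p)}_{2,l}(\alpha)=\sum_{s=0}^{l}\binom ls Q_p(s;-l-1,-l-1,l)\,\alpha^s=(1+\alpha)^{l-p}\,G_p^l(\alpha).$$ 4. $\binom{p-l-1}{p}\neq0$ and $G_p^l(\alpha)=\binom{p-l-1}{p}^{-1}P_p^{(-l-1,\,2l-2p+1)}(1+2\alpha)$ for all $\alpha\in\mathbb C$, where $$P_m^{(a,b)}(x)=\frac1{m!}\sum_{k=0}^m\binom mk(m+a+b+1)_k\,(a+k+1)_{m-k}\Bigl(\frac{x-1}2\Bigr)^k$$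 is the Jacobi polynomial. Consequently, let $\mathfrak{gl}_2=\mathfrak{gl}_2(\mathbb C)$ act on $\mathbb C[x_{11},x_{12},x_{21},x_{22}]$ by $E_{ij}\mapsto\sum_{s}x_{is}\,\partial/\partial x_{js}$, and put $\det^{(\alpha)}(X)=\sum_{\sigma\in\mathfrak S_2}\alpha^{\nu(\sigma)}x_{\sigma(1)1}x_{\sigma(2)2}$. Then for every $\alpha\in\mathbb C$ $$\mathcal U(\mathfrak{gl}_2)\cdot\det{}^{(\alpha)}(X)^l\;\cong\bigoplus_{\substack{0\le s\le l\\(1+\alpha)^{l-s}G_s^l(\alpha)\ne0}}\mathcal M_2^{(2l-s,s)},$$ where $\mathcal M_2^{\mu}$ is the irreducible $\mathfrak{gl}_2$-module of highest weight $\mu$. -/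

import Mathlib

/-!
Conventions.  The boxes of the rectangular standard tableau with `n` rows of length `l` are indexed
by `Fin n × Fin l`; the box `(i, j)` (counted from `0`) carries the number `i * l + j + 1`, so that
the symmetric group of degree `n * l` is `Equiv.Perm (Fin n × Fin l)`.
-/

noncomputable section

open scoped BigOperators

namespace AlphaDet

/-! ### Permutations -/

/-- `ν(σ) = ∑ (i - 1) m_i(σ)`, where `m_i(σ)` is the number of `i`-cycles of `σ`.  (Mathlib's
`cycleType` omits the fixed points, which contribute `0`.) -/
def nu {X : Type*} [Fintype X] [DecidableEq X] (σ : Equiv.Perm X) : ℕ :=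
  (σ.cycleType.map fun i => i - 1).sum

/-- The row group `K ≅ (S_l)^n` of the rectangular tableau. -/
def rowGroup (n l : ℕ) : Subgroup (Equiv.Perm (Fin n × Fin l)) where
  carrier := {g | ∀ x, (g x).1 = x.1}
  one_mem' := fun _ => rfl
  mul_mem' := fun {a b} ha hb x => (ha (b x)).trans (hb x)
  inv_mem' := fun {a} ha x => by
    have h := ha (a⁻¹ x)
    rw [show a (a⁻¹ x) = x from a.apply_symm_apply x] at h
    exact h.symm

/-- The column group `H ≅ (S_n)^l` of the rectangular tableau. -/
def colGroup (n l : ℕ) : Subgroup (Equiv.Perm (Fin n × Fin l)) where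
  carrier := {g | ∀ x, (g x).2 = x.2}
  one_mem' := fun _ => rfl
  mul_mem' := fun {a b} ha hb x => (ha (b x)).trans (hb x)
  inv_mem' := fun {a} ha x => by
    have h := ha (a⁻¹ x)
    rw [show a (a⁻¹ x) = x from a.apply_symm_apply x] at h
    exact h.symm

instance (n l : ℕ) : DecidablePred (· ∈ rowGroup n l) :=
  fun g => inferInstanceAs (Decidable (∀ x, (g x).1 = x.1))

instance (n l : ℕ) : DecidablePred (· ∈ colGroup n l) :=
  fun g => inferInstanceAs (Decidable (∀ x, (g x).2 = x.2))

/-- For `n = 2`: the product of the transpositions of the `i`-th boxes of the two rows, taken over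
the first `s` columns. -/
def gPerm (l s : ℕ) : Equiv.Perm (Fin 2 × Fin l) :=
  Function.Involutive.toPerm
    (fun x => if (x.2 : ℕ) < s then (Fin.rev x.1, x.2) else x)
    (fun x => by by_cases h : (x.2 : ℕ) < s <;> simp [h])

/-! ### Irreducible representations of the symmetric groups

`S^μ` is realised, as in Specht's original construction, as the span of the Specht polynomials (the
products of the Vandermonde polynomials of the columns) of all tableaux of shape `μ`. -/

section Specht

open MvPolynomial

variable {X : Type*} [Fintype X]

/-- The Specht polynomial of a tableau `T` (a bijective filling of the boxes of `μ` by `X`). -/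
def spechtPolynomial (μ : YoungDiagram) (T : μ.cells ≃ X) : MvPolynomial X ℂ :=
  ∏ c : μ.cells × μ.cells with (c.1 : ℕ × ℕ).2 = (c.2 : ℕ × ℕ).2 ∧
    (c.1 : ℕ × ℕ).1 < (c.2 : ℕ × ℕ).1, (MvPolynomial.X (T c.1) - MvPolynomial.X (T c.2))

/-- The action of the symmetric group on polynomials by permuting the variables. -/
def permRep (X : Type*) : Representation ℂ (Equiv.Perm X) (MvPolynomial X ℂ) where
  toFun g := (MvPolynomial.rename g).toLinearMap
  map_one' := by
    apply LinearMap.ext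
    intro p
    simp [Equiv.Perm.coe_one]
  map_mul' g h := by
    apply LinearMap.ext
    intro p
    simp [MvPolynomial.rename_rename]

/-- The Specht module of shape `μ` as a subrepresentation of the polynomials. -/
def spechtSub (X : Type*) [Fintype X] (μ : YoungDiagram) : Subrepresentation (permRep X) where
  toSubmodule := Submodule.span ℂ (Set.range fun T : μ.cells ≃ X => spechtPolynomial μ T)
  apply_mem_toSubmodule g v hv := by
    induction hv using Submodule.span_induction with
    | mem x hx =>
      obtain ⟨T, rfl⟩ := hx
      refine Submodule.subset_span ⟨T.trans g, ?_⟩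
      simp [permRep, spechtPolynomial, map_prod]
    | zero => simp
    | add x y _ _ hx hy => rw [map_add]; exact add_mem hx hy
    | smul a x _ hx => rw [map_smul]; exact Submodule.smul_mem _ a hx

/-- The underlying space of the irreducible representation `S^μ`. -/
abbrev SpechtModule (X : Type*) [Fintype X] (μ : YoungDiagram) : Type _ :=
  (spechtSub X μ).toSubmodule

/-- The irreducible representation `S^μ`. -/
def spechtRep (X : Type*) [Fintype X] (μ : YoungDiagram) :
    Representation ℂ (Equiv.Perm X) (SpechtModule X μ) :=
  (spechtSub X μ).toRepresentation

/-- The irreducible character `χ^μ`. -/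
def spechtChar (X : Type*) [Fintype X] (μ : YoungDiagram) (g : Equiv.Perm X) : ℂ :=
  LinearMap.trace ℂ (SpechtModule X μ) (spechtRep X μ g)

end Specht

/-- The partition `(2l - p, p)`, `0 ≤ p ≤ l`. -/
def twoRow (l p : ℕ) (hp : p ≤ l) : YoungDiagram :=
  YoungDiagram.ofRowLens [2 * l - p, p] (by
    simp [List.sortedGE_iff_pairwise]
    omega)

/-- The zonal spherical function `ω^μ(g) = |K|⁻¹ ∑_{k ∈ K} χ^μ(k g)`. -/
def zonal (n l : ℕ) (μ : YoungDiagram) (g : Equiv.Perm (Fin n × Fin l)) : ℂ :=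
  (Fintype.card (rowGroup n l) : ℂ)⁻¹ *
    ∑ k : rowGroup n l, spechtChar (Fin n × Fin l) μ ((k : Equiv.Perm (Fin n × Fin l)) * g)

/-! ### The transition matrix -/

section Transition

variable {n l : ℕ} {W : Type*} [NormedAddCommGroup W] [InnerProductSpace ℂ W]

/-- The subspace `W^K` of vectors invariant under the row group. -/
def rowInvariants {n l : ℕ} {V : Type*} [AddCommGroup V] [Module ℂ V]
    (ρ : Representation ℂ (Equiv.Perm (Fin n × Fin l)) V) : Submodule ℂ V :=
  Representation.invariants (ρ.comp (rowGroup n l).subtype)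

/-- `ρ` is a unitary representation that is isomorphic to `S^μ`. -/
structure IsUnitaryModel (μ : YoungDiagram)
    (ρ : Representation ℂ (Equiv.Perm (Fin n × Fin l)) W) : Prop where
  inner_map : ∀ g x y, inner ℂ (ρ g x) (ρ g y) = inner ℂ x y
  exists_equiv : ∃ φ : SpechtModule (Fin n × Fin l) μ ≃ₗ[ℂ] W,
    ∀ g v, φ (spechtRep (Fin n × Fin l) μ g v) = ρ g (φ v)

/-- The matrix coefficients `ψ_ij(g) = ⟨e_i · g, e_j⟩` with respect to an orthonormal basis
`e_1, …, e_d` of `W^K`.  The right action is `v · g = ρ(g⁻¹) v`; the inner product is linear in its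
first argument, so the arguments of Mathlib's `inner` are interchanged. -/
def psi (ρ : Representation ℂ (Equiv.Perm (Fin n × Fin l)) W) {d : ℕ}
    (e : OrthonormalBasis (Fin d) ℂ (rowInvariants ρ)) (i j : Fin d)
    (g : Equiv.Perm (Fin n × Fin l)) : ℂ :=
  inner ℂ (e j : W) (ρ g⁻¹ (e i : W))

/-- The transition matrix `F(α) = (∑_{h ∈ H} α^{ν(h)} ψ_ij(h))_{1 ≤ i, j ≤ d}`. -/
def transitionMatrix (ρ : Representation ℂ (Equiv.Perm (Fin n × Fin l)) W) {d : ℕ}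
    (e : OrthonormalBasis (Fin d) ℂ (rowInvariants ρ)) (α : ℂ) : Matrix (Fin d) (Fin d) ℂ :=
  Matrix.of fun i j => ∑ h : colGroup n l,
    α ^ nu (h : Equiv.Perm (Fin n × Fin l)) * psi ρ e i j (h : Equiv.Perm (Fin n × Fin l))

end Transition

/-! ### Hypergeometric polynomials -/

/-- The Pochhammer symbol `(a)_j = a (a + 1) ⋯ (a + j - 1)`. -/
def poch (a : ℂ) (j : ℕ) : ℂ := (ascPochhammer ℂ j).eval a

/-- The hypergeometric polynomial with upper parameters `as` and lower parameters `bs, -N`: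
`∑_{j=0}^{N} (∏ (a)_j) / ((∏ (b)_j) (-N)_j) * x^j / j!`. -/
def hypPoly (as bs : List ℂ) (N : ℕ) (x : ℂ) : ℂ :=
  ∑ j ∈ Finset.range (N + 1),
    (as.map fun a => poch a j).prod / ((bs.map fun b => poch b j).prod * poch (-(N : ℂ)) j) *
      (x ^ j / (j.factorial : ℂ))

/-- The Hahn polynomial `Q_p(x; a, b, N) = ₃F₂(-p, p + a + b + 1, -x; a + 1, -N; 1)`. -/
def hahn (p : ℕ) (x a b : ℂ) (N : ℕ) : ℂ :=
  hypPoly [-(p : ℂ), (p : ℂ) + a + b + 1, -x] [a + 1] N 1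

/-- `G_p^l(x) = ₂F₁(-p, l - p + 1; -l; -x)`. -/
def G (l p : ℕ) (x : ℂ) : ℂ :=
  hypPoly [-(p : ℂ), (l : ℂ) - p + 1] [] l (-x)

/-- The Jacobi polynomial `P_m^{(a, b)}(x)`, for arbitrary parameters:
`(1 / m!) ∑_k C(m, k) (m + a + b + 1)_k (a + k + 1)_{m - k} ((x - 1) / 2)^k`. -/
def jacobi (m : ℕ) (a b x : ℂ) : ℂ :=
  (m.factorial : ℂ)⁻¹ * ∑ k ∈ Finset.range (m + 1),
    (m.choose k : ℂ) * poch ((m : ℂ) + a + b + 1) k * poch (a + k + 1) (m - k) *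
      ((x - 1) / 2) ^ k

/-! ### The cyclic module -/

section Cyclic

attribute [local instance 100] LieRing.ofAssociativeRing

/-- The polynomial algebra in the variables `x_ij`, `1 ≤ i, j ≤ n`. -/
abbrev Poly (n : ℕ) : Type := MvPolynomial (Fin n × Fin n) ℂ

/-- The `α`-determinant `∑_σ α^{ν(σ)} x_{σ(1)1} ⋯ x_{σ(n)n}` of `X = (x_ij)`. -/
def alphaDet (n : ℕ) (α : ℂ) : Poly n :=
  ∑ σ : Equiv.Perm (Fin n), MvPolynomial.C (α ^ nu σ) * ∏ i, MvPolynomial.X (σ i, i)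

/-- For `A = ∑ A_ij E_ij`, the derivation `∑_ij A_ij ∑_s x_is ∂/∂x_js`; it sends `x_js` to
`∑_i A_ij x_is`. -/
def glDer {n : ℕ} (A : Matrix (Fin n) (Fin n) ℂ) : Derivation ℂ (Poly n) (Poly n) :=
  MvPolynomial.mkDerivation ℂ fun js => ∑ i, A i js.1 • MvPolynomial.X (i, js.2)

/-- The action of `gl_n` on polynomials, `E_ij ↦ ∑_s x_is ∂/∂x_js`. -/
def glHom (n : ℕ) : Matrix (Fin n) (Fin n) ℂ →ₗ⁅ℂ⁆ Module.End ℂ (Poly n) where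
  toFun A := (glDer A : Poly n →ₗ[ℂ] Poly n)
  map_add' A B := by
    rw [← Derivation.coe_add_linearMap]
    congr 1
    apply MvPolynomial.derivation_ext
    intro i
    simp [glDer, MvPolynomial.mkDerivation_X, add_smul, Finset.sum_add_distrib]
  map_smul' c A := by
    rw [RingHom.id_apply, ← Derivation.coe_smul_linearMap]
    congr 1
    apply MvPolynomial.derivation_ext
    intro i
    simp [glDer, MvPolynomial.mkDerivation_X, Finset.smul_sum, smul_smul]
  map_lie' {A B} := by
    rw [← Derivation.commutator_coe_linear_map]
    congr 1
    apply MvPolynomial.derivation_ext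
    rintro ⟨a, b⟩
    simp only [glDer, Derivation.commutator_apply, MvPolynomial.mkDerivation_X, map_sum,
      Derivation.map_smul, Ring.lie_def, Matrix.sub_apply, Matrix.mul_apply, sub_smul,
      Finset.sum_smul, Finset.smul_sum, smul_smul, Finset.sum_sub_distrib]
    congr 1
    · rw [Finset.sum_comm]
      exact Finset.sum_congr rfl fun y _ => Finset.sum_congr rfl fun x _ => by rw [mul_comm]
    · rw [Finset.sum_comm]
      exact Finset.sum_congr rfl fun y _ => Finset.sum_congr rfl fun x _ => by rw [mul_comm]

/-- The action of the universal enveloping algebra `U(gl_n)` on polynomials. -/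
def uHom (n : ℕ) :
    UniversalEnvelopingAlgebra ℂ (Matrix (Fin n) (Fin n) ℂ) →ₐ[ℂ] Module.End ℂ (Poly n) :=
  UniversalEnvelopingAlgebra.lift ℂ (glHom n)

/-- The cyclic module `U(gl_n) · det^(α)(X)^l`. -/
def cyclicModule (n l : ℕ) (α : ℂ) : Submodule ℂ (Poly n) :=
  LinearMap.range ((LinearMap.applyₗ (alphaDet n α ^ l)).comp (uHom n).toLinearMap)

/-- `N` is stable under the action of `gl_n` (equivalently, of `U(gl_n)`). -/
def GlStable {n : ℕ} (N : Submodule ℂ (Poly n)) : Prop :=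
  ∀ A, ∀ f ∈ N, glHom n A f ∈ N

/-- `N` is an irreducible `gl_n`-submodule with highest weight `wt`. -/
structure IsIrredOfHighestWeight {n : ℕ} (N : Submodule ℂ (Poly n)) (wt : Fin n → ℂ) : Prop where
  stable : GlStable N
  ne_bot : N ≠ ⊥
  irred : ∀ N' ≤ N, GlStable N' → N' = ⊥ ∨ N' = N
  exists_highest : ∃ v ∈ N, v ≠ 0 ∧
    (∀ i, glHom n (Matrix.single i i 1) v = wt i • v) ∧
    (∀ i j, i < j → glHom n (Matrix.single i j 1) v = 0)

end Cyclic

end AlphaDet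

end

noncomputable section

open scoped BigOperators

namespace AlphaDet

/-! ### Pochhammer symbols -/

/-! Let `K` be the row group. The Specht module of `(2l - p, p)` is spanned by products of `p`
differences `x_a - x_b` over disjoint pairs of boxes. Evaluation `ev` at the indicator of the first
row is `K`-invariant, and averaging over `K` is the rank-one operator `v ↦ ev(v) v₀` (`average_eq`):
a pair inside one row makes both sides vanish, and otherwise the product is, up to a sign seen by
`ev`, a `K`-translate of the standard one. Hence the invariants form a line and the zonal function
is `g ↦ ev(g v₀)` (`average_trace`). In a unitary model the normalized matrix coefficient of an
invariant vector is the same function.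

A column group element is the flip of a set `A` of columns, and `ν` of the flip is `|A|`. There
`ev(g v₀)` is an average over pairs of permutations depending only on `s = |A|`
(`sum_perm_prod_sub`); two Chu–Vandermonde summations identify it with a Hahn polynomial
(`zonal_sum_eq_hahn`). Grouping by `s` gives the binomial sum for `F`, and one more Chu–Vandermonde
gives its closed form (`sum_choose_mul_pow`).

For the cyclic module, `det^(α)(X)^l` lies in the space spanned by `(x_11 x_22)^(l-j) (x_12
x_21)^j`, `0 ≤ j ≤ l`. The zero weight vectors of the modules generated by `det^s (x_11 x_12)^(l-s)`
are Casimir eigenvectors with distinct eigenvalues, so they form a basis of this space. By the Hahn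
difference equation, the functional with values `Q_s(j)` is an eigenvector of the transposed
Casimir, so it detects exactly the `s`-th component; on `det^(α)(X)^l` it takes the value `(1 +
α)^(l-s) G_s^l(α)`. A stable subspace contains every component of its elements of this space, and
irreducibility does the rest. -/

theorem poch_zero (a : ℂ) : poch a 0 = 1 := by simp [poch]

theorem poch_succ (a : ℂ) (j : ℕ) : poch a (j + 1) = poch a j * (a + j) :=
  ascPochhammer_succ_eval j a

theorem poch_succ_left (a : ℂ) (j : ℕ) : poch a (j + 1) = a * poch (a + 1) j := by
  simp [poch, ascPochhammer_succ_left, Polynomial.eval_comp]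

theorem poch_add (a : ℂ) (i j : ℕ) : poch a (i + j) = poch a i * poch (a + i) j := by
  simp [poch, ← ascPochhammer_mul, Polynomial.eval_comp]

theorem poch_neg_natCast (s j : ℕ) :
    poch (-(s : ℂ)) j = (-1) ^ j * (j.factorial : ℂ) * (s.choose j : ℂ) := by
  rw [poch, ascPochhammer_eval_neg_eq_descPochhammer, descPochhammer_eval_eq_descFactorial,
    Nat.descFactorial_eq_factorial_mul_choose]
  push_cast
  ring

/-- The denominators `(-l)_j` are harmless exactly in the range `j ≤ l`; this is where `p ≤ l`
enters the hypergeometric identities. -/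
theorem poch_neg_natCast_ne_zero {l j : ℕ} (h : j ≤ l) : poch (-(l : ℂ)) j ≠ 0 := by
  rw [poch_neg_natCast]
  have h1 := (Nat.choose_pos h).ne'
  have h2 := j.factorial_ne_zero
  have h3 : ((-1 : ℂ)) ^ j ≠ 0 := by simp
  simp_all

theorem poch_neg_div_poch_neg {s l j : ℕ} (h : j ≤ l) :
    poch (-(s : ℂ)) j / poch (-(l : ℂ)) j = (s.choose j : ℂ) / (l.choose j : ℂ) := by
  have h1 := (Nat.choose_pos h).ne'
  have h2 := j.factorial_ne_zero
  have h3 : ((-1 : ℂ)) ^ j ≠ 0 := by simp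
  rw [poch_neg_natCast, poch_neg_natCast]
  have : (l.choose j : ℂ) ≠ 0 := by exact_mod_cast h1
  have : (j.factorial : ℂ) ≠ 0 := by exact_mod_cast h2
  field_simp

/-- Reversal of the factors of a Pochhammer symbol. -/
theorem poch_reflect (a : ℂ) (i : ℕ) : poch (-a - i + 1) i = (-1) ^ i * poch a i := by
  induction i generalizing a with
  | zero => simp [poch_zero]
  | succ i ih =>
    rw [poch_succ, show -a - ((i + 1 : ℕ) : ℂ) + 1 = -(a + 1) - i + 1 by push_cast; ring, ih,
      poch_succ_left]
    ring

/-! ### Binomial sums -/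

/-- Interchange of summation in `∑ C(p, j) C(j, i) F(i, j)`. -/
theorem sum_choose_mul_choose_comm (p : ℕ) (F : ℕ → ℕ → ℂ) :
    ∑ j ∈ Finset.range (p + 1), (p.choose j : ℂ) *
        ∑ i ∈ Finset.range (j + 1), (j.choose i : ℂ) * F i j =
      ∑ i ∈ Finset.range (p + 1), (p.choose i : ℂ) *
        ∑ t ∈ Finset.range (p - i + 1), ((p - i).choose t : ℂ) * F i (i + t) := by
  simp_rw [Finset.mul_sum]
  rw [Finset.sum_comm' (t' := Finset.range (p + 1)) (s' := fun i => Finset.Ico i (p + 1))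
    (by intro x y; simp only [Finset.mem_range, Finset.mem_Ico]; omega)]
  refine Finset.sum_congr rfl fun i hi => ?_
  rw [Finset.mem_range] at hi
  rw [Finset.sum_Ico_eq_sum_range, show p + 1 - i = p - i + 1 by omega]
  refine Finset.sum_congr rfl fun t ht => ?_
  rw [Finset.mem_range] at ht
  have := Nat.choose_mul (n := p) (k := i + t) (s := i) (by omega)
  rw [Nat.add_sub_cancel_left] at this
  rw [← mul_assoc, ← mul_assoc]
  congr 1
  exact_mod_cast this

/-- The Chu–Vandermonde summation of `₂F₁(-k, b; c; 1)`. -/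
theorem chu_vandermonde (k : ℕ) (b c : ℂ) (hc : poch c k ≠ 0) :
    ∑ j ∈ Finset.range (k + 1), (k.choose j : ℂ) * ((-1) ^ j * (poch b j / poch c j)) =
      poch (c - b) k / poch c k := by
  induction k generalizing c with
  | zero => simp [poch_zero]
  | succ k ih =>
    have hc' := hc
    rw [poch_succ_left, mul_ne_zero_iff] at hc'
    obtain ⟨hc0, hc1⟩ := hc'
    have hne : ∀ j ≤ k, poch c (j + 1) ≠ 0 := by
      intro j hj h
      apply hc
      obtain ⟨d, hd⟩ := Nat.exists_eq_add_of_le hj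
      rw [hd, show j + d + 1 = (j + 1) + d by omega, poch_add, h, zero_mul]
    -- Pascal's rule: an alternating binomial sum of order `k + 1` is one of order `k` over the
    -- differences of `g`.
    have step : ∀ g : ℕ → ℂ, ∑ j ∈ Finset.range (k + 1 + 1), ((k + 1).choose j : ℂ) *
        ((-1) ^ j * g j) = ∑ j ∈ Finset.range (k + 1), (k.choose j : ℂ) *
          ((-1) ^ j * (g j - g (j + 1))) := by
      intro g
      rw [Finset.sum_range_succ']
      simp_rw [Nat.choose_succ_succ, Nat.cast_add, add_mul, mul_sub]
      rw [Finset.sum_add_distrib, Finset.sum_sub_distrib]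
      have h1 := Finset.sum_range_succ' (fun j => (k.choose j : ℂ) * ((-1) ^ j * g j)) (k + 1)
      rw [Finset.sum_range_succ] at h1
      simp only [Nat.choose_succ_self, Nat.cast_zero, zero_mul, add_zero, pow_zero, one_mul,
        Nat.choose_zero_right, Nat.cast_one] at h1 ⊢
      rw [h1, ← sub_eq_zero]
      simp only [pow_succ, mul_neg, mul_one, neg_mul, Finset.sum_neg_distrib]
      simp only [Nat.succ_eq_add_one]
      ring
    rw [step, poch_succ_left (c - b), poch_succ_left c]
    -- For `g j = (b)_j / (c)_j` the difference is a multiple of `(b)_j / (c + 1)_j`, so the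
    -- induction continues with `c + 1`.
    have key : ∀ j ∈ Finset.range (k + 1), (k.choose j : ℂ) *
        ((-1) ^ j * (poch b j / poch c j - poch b (j + 1) / poch c (j + 1))) =
        (c - b) / c * ((k.choose j : ℂ) * ((-1) ^ j * (poch b j / poch (c + 1) j))) := by
      intro j hj
      rw [Finset.mem_range] at hj
      have h2 := hne j (by omega)
      have h3 := h2
      rw [poch_succ, mul_ne_zero_iff] at h2
      have h4 : poch c j * (c + j) = c * poch (c + 1) j := by rw [← poch_succ, poch_succ_left]
      have h5 := h3
      rw [poch_succ_left, mul_ne_zero_iff] at h5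
      obtain ⟨h6, h7⟩ := h2
      have h8 := h5.2
      have : poch b j / poch c j - poch b (j + 1) / poch c (j + 1) =
          (c - b) / c * (poch b j / poch (c + 1) j) := by
        rw [poch_succ b, poch_succ c, div_mul_div_comm, ← h4]
        field_simp
        ring
      rw [this]
      ring
    rw [Finset.sum_congr rfl key, ← Finset.mul_sum, ih (c + 1) hc1, div_mul_div_comm,
      show c + 1 - b = c - b + 1 by ring]

/-! ### Hahn polynomials with parameters `(-l - 1, -l - 1, l)` -/

/-- `(-p)_j / j! = (-1)^j C(p, j)` vanishes beyond `p`, so the sum may stop there. Since `a + 1 =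
-l`, both lower parameters equal `-l`. -/
theorem hahn_eq (l p : ℕ) (hp : p ≤ l) (x : ℂ) :
    hahn p x (-(l : ℂ) - 1) (-(l : ℂ) - 1) l =
      ∑ j ∈ Finset.range (p + 1), (p.choose j : ℂ) * ((-1) ^ j *
        (poch (p - 2 * l - 1) j / poch (-(l : ℂ)) j) * (poch (-x) j / poch (-(l : ℂ)) j)) := by
  rw [hahn, hypPoly]
  symm
  refine Finset.sum_subset_zero_on_sdiff (by simpa using hp) ?_ ?_
  · intro j hj
    simp only [Finset.mem_sdiff, Finset.mem_range, not_lt] at hj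
    simp [poch_neg_natCast, Nat.choose_eq_zero_of_lt (show p < j by omega)]
  · intro j hj
    rw [Finset.mem_range] at hj
    have h := poch_neg_natCast_ne_zero (l := l) (j := j) (by omega)
    have h2 : (j.factorial : ℂ) ≠ 0 := by exact_mod_cast j.factorial_ne_zero
    simp only [List.map_cons, List.map_nil, List.prod_cons, List.prod_nil, mul_one, one_pow,
      sub_add_cancel]
    rw [poch_neg_natCast p j, show (p : ℂ) + (-(l : ℂ) - 1) + (-(l : ℂ) - 1) + 1 = p - 2 * l - 1
      by ring]
    field_simp

theorem G_eq (l p : ℕ) (hp : p ≤ l) (x : ℂ) :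
    G l p x = ∑ j ∈ Finset.range (p + 1), (p.choose j : ℂ) *
      (poch ((l : ℂ) - p + 1) j / poch (-(l : ℂ)) j * x ^ j) := by
  rw [G, hypPoly]
  symm
  refine Finset.sum_subset_zero_on_sdiff (by simpa using hp) ?_ ?_
  · intro j hj
    simp only [Finset.mem_sdiff, Finset.mem_range, not_lt] at hj
    simp [poch_neg_natCast, Nat.choose_eq_zero_of_lt (show p < j by omega)]
  · intro j hj
    rw [Finset.mem_range] at hj
    have h := poch_neg_natCast_ne_zero (l := l) (j := j) (by omega)
    have h2 : (j.factorial : ℂ) ≠ 0 := by exact_mod_cast j.factorial_ne_zero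
    simp only [List.map_cons, List.map_nil, List.prod_cons, List.prod_nil, mul_one, one_mul]
    rw [poch_neg_natCast p j, neg_pow x]
    have h3 : ((-1 : ℂ)) ^ j * (-1) ^ j = 1 := by rw [← mul_pow]; simp
    field_simp
    linear_combination (-(p.choose j : ℂ) * poch ((l : ℂ) - p + 1) j * x ^ j) * h3

/-- Summing over `s` first turns the Hahn term of index `j` into `α^j (1 + α)^(l-j)`. On the other
side Chu–Vandermonde with `b = p - 2l - 1`, `c = -l` expands the coefficients of `G`, and the
binomial theorem matches the two. -/
theorem sum_choose_mul_pow (l p : ℕ) (hp : p ≤ l) (α : ℂ) :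
    ∑ s ∈ Finset.range (l + 1),
        (l.choose s : ℂ) * hahn p s (-(l : ℂ) - 1) (-(l : ℂ) - 1) l * α ^ s =
      (1 + α) ^ (l - p) * G l p α := by
  -- `C(l, s) C(s, j) = C(l, j) C(l - j, s - j)` reduces this to a shifted binomial theorem; the
  -- terms `s < j` vanish.
  have inner : ∀ j ≤ p, ∑ s ∈ Finset.range (l + 1), (l.choose s : ℂ) *
      (poch (-(s : ℂ)) j / poch (-(l : ℂ)) j) * α ^ s = α ^ j * (1 + α) ^ (l - j) := by
    intro j hj
    rw [add_comm 1 α, add_pow, Finset.mul_sum]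
    have : Finset.range (l + 1) = Finset.Ico 0 (l + 1) := by simp
    rw [this, ← Finset.sum_Ico_consecutive _ (Nat.zero_le j) (show j ≤ l + 1 by omega)]
    rw [Finset.sum_eq_zero, zero_add, Finset.sum_Ico_eq_sum_range,
      show l + 1 - j = l - j + 1 by omega]
    · refine Finset.sum_congr rfl fun t ht => ?_
      rw [Finset.mem_range] at ht
      rw [poch_neg_div_poch_neg (by omega)]
      have h1 : (l.choose j : ℂ) ≠ 0 := by exact_mod_cast (Nat.choose_pos (by omega)).ne'
      have := Nat.choose_mul (n := l) (k := j + t) (s := j) (by omega)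
      rw [Nat.add_sub_cancel_left] at this
      have h2 : (l.choose (j + t) : ℂ) * ((j + t).choose j : ℂ) =
        (l.choose j : ℂ) * ((l - j).choose t : ℂ) := by exact_mod_cast this
      field_simp
      rw [h2, pow_add]
      ring
    · intro s hs
      rw [Finset.mem_Ico] at hs
      simp [poch_neg_natCast, Nat.choose_eq_zero_of_lt hs.2]
  have h1 : ∀ s ∈ Finset.range (l + 1),
      (l.choose s : ℂ) * hahn p s (-(l : ℂ) - 1) (-(l : ℂ) - 1) l * α ^ s =
      ∑ j ∈ Finset.range (p + 1), (p.choose j : ℂ) * ((-1) ^ j *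
        (poch (p - 2 * l - 1) j / poch (-(l : ℂ)) j)) *
        ((l.choose s : ℂ) * (poch (-(s : ℂ)) j / poch (-(l : ℂ)) j) * α ^ s) := by
    intro s _
    rw [hahn_eq l p hp, Finset.mul_sum, Finset.sum_mul]
    exact Finset.sum_congr rfl fun j _ => by ring
  rw [Finset.sum_congr rfl h1, Finset.sum_comm]
  simp_rw [← Finset.mul_sum]
  rw [G_eq l p hp, Finset.mul_sum]
  have h2 : ∀ k ∈ Finset.range (p + 1), (1 + α) ^ (l - p) * ((p.choose k : ℂ) *
      (poch ((l : ℂ) - p + 1) k / poch (-(l : ℂ)) k * α ^ k)) =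
      (1 + α) ^ (l - p) * ((p.choose k : ℂ) * ∑ j ∈ Finset.range (k + 1), (k.choose j : ℂ) *
      ((-1) ^ j * (poch (p - 2 * l - 1) j / poch (-(l : ℂ)) j) * α ^ k)) := by
    intro k hk
    rw [Finset.mem_range] at hk
    have := chu_vandermonde k (p - 2 * l - 1) (-(l : ℂ)) (poch_neg_natCast_ne_zero (by omega))
    rw [show -(l : ℂ) - (p - 2 * l - 1) = l - p + 1 by ring] at this
    rw [← this, Finset.sum_mul]
    simp_rw [mul_assoc]
  rw [Finset.sum_congr rfl h2, ← Finset.mul_sum, sum_choose_mul_choose_comm p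
    (fun j k => (-1) ^ j * (poch (p - 2 * l - 1) j / poch (-(l : ℂ)) j) * α ^ k), Finset.mul_sum]
  refine Finset.sum_congr rfl fun j hj => ?_
  rw [Finset.mem_range] at hj
  rw [inner j (by omega), show l - j = (l - p) + (p - j) by omega, pow_add, add_comm 1 α,
    add_pow α 1 (p - j)]
  simp_rw [Finset.mul_sum]
  refine Finset.sum_congr rfl fun t _ => ?_
  rw [pow_add]
  ring

/-- Chu–Vandermonde expands `(p - 2l - 1)_j / (-l)_j` as a sum over `i ≤ j`. After the interchange,
the sum over `j = i + t` is again Chu–Vandermonde, with parameters `i - s` and `i - l`. -/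
theorem zonal_sum_eq_hahn (l p s : ℕ) (hp : p ≤ l) :
    ∑ j ∈ Finset.range (p + 1), (p.choose j : ℂ) * ((-1) ^ j *
      (poch (-(s : ℂ)) j / poch (-(l : ℂ)) j) *
      (poch ((s : ℂ) - l) (p - j) / poch (-(l : ℂ)) (p - j))) =
      hahn p s (-(l : ℂ) - 1) (-(l : ℂ) - 1) l := by
  rw [hahn_eq l p hp]
  have h1 : ∀ j ∈ Finset.range (p + 1), (p.choose j : ℂ) * ((-1) ^ j *
        (poch (p - 2 * l - 1) j / poch (-(l : ℂ)) j) * (poch (-(s : ℂ)) j / poch (-(l : ℂ)) j)) =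
      (p.choose j : ℂ) * ∑ i ∈ Finset.range (j + 1), (j.choose i : ℂ) *
        ((-1) ^ i * (-1) ^ j * (poch (l - p + 1) i / poch (-(l : ℂ)) i) *
          (poch (-(s : ℂ)) j / poch (-(l : ℂ)) j)) := by
    intro j hj
    rw [Finset.mem_range] at hj
    have := chu_vandermonde j (l - p + 1) (-(l : ℂ)) (poch_neg_natCast_ne_zero (by omega))
    rw [show -(l : ℂ) - (l - p + 1) = p - 2 * l - 1 by ring] at this
    rw [← this, Finset.mul_sum, Finset.sum_mul]
    congr 1
    exact Finset.sum_congr rfl fun i _ => by ring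
  rw [Finset.sum_congr rfl h1, sum_choose_mul_choose_comm p (fun i j => (-1) ^ i * (-1) ^ j *
    (poch (l - p + 1) i / poch (-(l : ℂ)) i) * (poch (-(s : ℂ)) j / poch (-(l : ℂ)) j))]
  refine Finset.sum_congr rfl fun i hi => ?_
  rw [Finset.mem_range] at hi
  congr 1
  have hl : ((l - i : ℕ) : ℂ) = l - i := by push_cast [show i ≤ l by omega]; ring
  have hpi : ((p - i : ℕ) : ℂ) = p - i := by push_cast [show i ≤ p by omega]; ring
  have hpl : poch (-(l : ℂ)) p ≠ 0 := poch_neg_natCast_ne_zero hp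
  -- Two factorizations of `(-l)_p`, split at `i` and at `p - i` (the latter with its tail
  -- reversed), reconcile the denominators of the two sides.
  have e1 : poch (-(l : ℂ)) p = poch (-(l : ℂ)) i * poch (i - l) (p - i) := by
    conv_lhs => rw [show p = i + (p - i) by omega, poch_add]
    rw [show -(l : ℂ) + i = i - l by ring]
  have e2 : poch (-(l : ℂ)) p = poch (-(l : ℂ)) (p - i) * ((-1) ^ i * poch (l - p + 1) i) := by
    conv_lhs => rw [show p = (p - i) + i by omega, poch_add]
    rw [← poch_reflect, hpi]
    congr 2
    ring
  have hsq : ((-1 : ℂ)) ^ i * (-1) ^ i = 1 := by rw [← mul_pow]; simp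
  have hne : poch ((i : ℂ) - l) (p - i) ≠ 0 := by
    rw [show (i : ℂ) - l = -((l - i : ℕ) : ℂ) by rw [hl]; ring]
    exact poch_neg_natCast_ne_zero (by omega)
  have cv := chu_vandermonde (p - i) (i - s) (i - l) hne
  rw [show (i : ℂ) - l - (i - s) = s - l by ring] at cv
  have h2 : ∀ t ∈ Finset.range (p - i + 1), ((p - i).choose t : ℂ) * ((-1) ^ i * (-1) ^ (i + t) *
      (poch (l - p + 1) i / poch (-(l : ℂ)) i) *
        (poch (-(s : ℂ)) (i + t) / poch (-(l : ℂ)) (i + t))) =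
      (poch (l - p + 1) i / poch (-(l : ℂ)) i) * (poch (-(s : ℂ)) i / poch (-(l : ℂ)) i) *
      (((p - i).choose t : ℂ) * ((-1) ^ t * (poch (i - s) t / poch (i - l) t))) := by
    intro t _
    rw [poch_add, poch_add, pow_add, show -(l : ℂ) + i = i - l by ring,
      show -(s : ℂ) + i = i - s by ring, mul_div_mul_comm]
    linear_combination ((p - i).choose t : ℂ) * ((-1) ^ t * (poch (l - p + 1) i /
      poch (-(l : ℂ)) i) * (poch (-(s : ℂ)) i / poch (-(l : ℂ)) i) *
        (poch (i - s) t / poch (i - l) t)) * hsq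
  rw [Finset.sum_congr rfl h2, ← Finset.mul_sum, cv]
  have n1 : poch (-(l : ℂ)) i ≠ 0 := poch_neg_natCast_ne_zero (by omega)
  have n2 : poch (-(l : ℂ)) (p - i) ≠ 0 := poch_neg_natCast_ne_zero (by omega)
  field_simp
  linear_combination (poch (-(s : ℂ)) i * poch (s - l) (p - i) * (-1) ^ i) * (e2 - e1) +
    (poch (-(s : ℂ)) i * poch (s - l) (p - i) * poch (-(l : ℂ)) (p - i) * poch (l - p + 1) i) * hsq

/-- The difference operator of the Hahn polynomials on the basis `(-x)_i`. -/
theorem poch_difference (l x : ℂ) (k : ℕ) :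
    (l - x) ^ 2 * (poch (-(x + 1)) (k + 1) - poch (-x) (k + 1)) -
      x ^ 2 * (poch (-x) (k + 1) - poch (-(x - 1)) (k + 1)) =
    -(k + 1) * ((l - k) ^ 2 * poch (-x) k + (2 * l - k) * poch (-x) (k + 1)) := by
  have e1 : poch (-(x + 1)) (k + 1) = -(x + 1) * poch (-x) k := by
    rw [poch_succ_left, show -(x + 1) + 1 = -x by ring]
  have e2 : poch (-x) (k + 1) = poch (-x) k * (-x + k) := poch_succ _ _
  have e3 : poch (-x) (k + 1) = -x * poch (-(x - 1)) k := by
    rw [poch_succ_left, show -x + 1 = -(x - 1) by ring]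
  have e4 : poch (-(x - 1)) (k + 1) = poch (-(x - 1)) k * (-(x - 1) + k) := poch_succ _ _
  rw [e1, e4]
  have e5 : x * poch (-(x - 1)) k = -(poch (-x) k * (-x + k)) := by
    rw [← e2, e3]; ring
  rw [e2]
  linear_combination (x * (-(x - 1) + k)) * e5

/-- On the basis `(-x)_i` the difference operator has only two terms, of indices `i` and `i - 1`
(`poch_difference`), so the eigenvalue equation becomes a telescoping sum. -/
theorem hahn_difference_aux (l p : ℕ) (hp : p ≤ l) (x : ℂ) :
    ((l : ℂ) - x) ^ 2 * (hahn p (x + 1) (-(l : ℂ) - 1) (-(l : ℂ) - 1) l -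
        hahn p x (-(l : ℂ) - 1) (-(l : ℂ) - 1) l) -
      x ^ 2 * (hahn p x (-(l : ℂ) - 1) (-(l : ℂ) - 1) l -
        hahn p (x - 1) (-(l : ℂ) - 1) (-(l : ℂ) - 1) l) +
      p * (2 * l + 1 - p) * hahn p x (-(l : ℂ) - 1) (-(l : ℂ) - 1) l = 0 := by
  set c : ℕ → ℂ := fun i => (p.choose i : ℂ) * ((-1) ^ i *
    (poch (p - 2 * l - 1) i / poch (-(l : ℂ)) i) / poch (-(l : ℂ)) i) with hc
  have hQ : ∀ y, hahn p y (-(l : ℂ) - 1) (-(l : ℂ) - 1) l =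
      ∑ i ∈ Finset.range (p + 1), c i * poch (-y) i := by
    intro y
    rw [hahn_eq l p hp]
    exact Finset.sum_congr rfl fun i _ => by rw [hc]; ring
  -- The hypergeometric ratio of consecutive coefficients, which is what makes the sum telescope.
  have hstep : ∀ k < p, c (k + 1) * ((k + 1) * (l - k) ^ 2) =
      c k * ((p - k) * (2 * l + 1 - p - k)) := by
    intro k hk
    have n1 : poch (-(l : ℂ)) (k + 1) ≠ 0 := poch_neg_natCast_ne_zero (by omega)
    have n2 := n1
    rw [poch_succ, mul_ne_zero_iff] at n2
    have h1 : ((p.choose (k + 1) : ℕ) : ℂ) * (k + 1) = p.choose k * (p - k) := by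
      have := Nat.choose_succ_right_eq p k
      rw [← Nat.cast_sub hk.le]
      exact_mod_cast this
    simp only [hc]
    rw [poch_succ (-(l : ℂ)), poch_succ ((p : ℂ) - 2 * l - 1), pow_succ]
    obtain ⟨n3, n4⟩ := n2
    field_simp
    linear_combination ((l - k) ^ 2 * (p - 2 * l - 1 + k) * (-1) * poch (p - 2 * l - 1) k) * h1
  -- Each partial sum leaves a single boundary term, with a factor `p - n` that vanishes at `n = p`.
  have main : ∀ n ≤ p, ∑ i ∈ Finset.range (n + 1), c i *
      ((l - x) ^ 2 * (poch (-(x + 1)) i - poch (-x) i) -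
      x ^ 2 * (poch (-x) i - poch (-(x - 1)) i) + p * (2 * l + 1 - p) * poch (-x) i) =
      c n * ((p - n) * (2 * l + 1 - p - n)) * poch (-x) n := by
    intro n hn
    induction n with
    | zero => simp [poch_zero]
    | succ k ih =>
      rw [Finset.sum_range_succ, ih (by omega), poch_difference, ← hstep k (by omega)]
      push_cast
      ring
  have := main p le_rfl
  rw [sub_self, zero_mul, mul_zero, zero_mul] at this
  rw [← this]
  simp_rw [hQ, ← Finset.sum_sub_distrib, Finset.mul_sum]
  rw [← Finset.sum_sub_distrib, ← Finset.sum_add_distrib]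
  exact Finset.sum_congr rfl fun i _ => by ring

/-- The difference equation of the Hahn polynomials. -/
theorem hahn_difference (l p j : ℕ) (hp : p ≤ l) :
    ((l : ℂ) - j) ^ 2 * hahn p (j + 1 : ℕ) (-(l : ℂ) - 1) (-(l : ℂ) - 1) l +
      (l + 2 * j * (l - j)) * hahn p j (-(l : ℂ) - 1) (-(l : ℂ) - 1) l +
      (j : ℂ) ^ 2 * hahn p (j - 1 : ℕ) (-(l : ℂ) - 1) (-(l : ℂ) - 1) l =
    ((l : ℂ) - p) * (l - p + 1) * hahn p j (-(l : ℂ) - 1) (-(l : ℂ) - 1) l := by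
  have h := hahn_difference_aux l p hp j
  -- At `j = 0` truncated subtraction replaces `-1` by `0`, but the factor `j ^ 2` is zero.
  have h2 : (j : ℂ) ^ 2 * hahn p (j - 1 : ℕ) (-(l : ℂ) - 1) (-(l : ℂ) - 1) l =
      (j : ℂ) ^ 2 * hahn p (j - 1) (-(l : ℂ) - 1) (-(l : ℂ) - 1) l := by
    rcases j with _ | j
    · simp
    · simp
  rw [h2, Nat.cast_succ]
  linear_combination h

theorem hahn_zero (l p : ℕ) (hp : p ≤ l) : hahn p 0 (-(l : ℂ) - 1) (-(l : ℂ) - 1) l = 1 := by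
  rw [hahn_eq l p hp, Finset.sum_range_succ', Finset.sum_eq_zero]
  · simp [poch_zero]
  · intro i _
    simp [poch_succ_left]

/-- `p! C(p - l - 1, p)` is the falling product from `p - l - 1` down to `-l`; read upwards it is
`(-l)_p`. -/
theorem ringChoose_mul_factorial (l p : ℕ) :
    ((Ring.choose ((p : ℤ) - l - 1) p : ℤ) : ℂ) * p.factorial = poch (-(l : ℂ)) p := by
  have h := Ring.descPochhammer_eq_factorial_smul_choose ((p : ℤ) - l - 1) p
  have h2 : (((descPochhammer ℤ p).smeval ((p : ℤ) - l - 1) : ℤ) : ℂ) = poch (-(l : ℂ)) p := by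
    rw [← Polynomial.eval_eq_smeval, descPochhammer_eval_cast,
      descPochhammer_eval_eq_ascPochhammer, poch]
    congr 1
    push_cast
    ring
  rw [← h2, h]
  simp [mul_comm]

/-- The identity holds coefficient by coefficient, after writing `(-l)_p = (-l)_j (j - l)_(p-j)`. -/
theorem G_eq_jacobi (l p : ℕ) (hp : p ≤ l) :
    Ring.choose ((p : ℤ) - l - 1) p ≠ 0 ∧
      ∀ α : ℂ, G l p α = ((Ring.choose ((p : ℤ) - l - 1) p : ℤ) : ℂ)⁻¹ *
        jacobi p (-(l : ℂ) - 1) (2 * (l : ℂ) - 2 * p + 1) (1 + 2 * α) := by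
  have h := ringChoose_mul_factorial l p
  have h0 : poch (-(l : ℂ)) p ≠ 0 := poch_neg_natCast_ne_zero hp
  have hf : (p.factorial : ℂ) ≠ 0 := by exact_mod_cast p.factorial_ne_zero
  have hc : ((Ring.choose ((p : ℤ) - l - 1) p : ℤ) : ℂ) ≠ 0 := by
    intro hc
    rw [hc, zero_mul] at h
    exact h0 h.symm
  refine ⟨by exact_mod_cast hc, fun α => ?_⟩
  rw [jacobi, ← mul_assoc, ← mul_inv, h, G_eq l p hp, Finset.mul_sum]
  refine Finset.sum_congr rfl fun j hj => ?_
  rw [Finset.mem_range] at hj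
  have e1 : poch (-(l : ℂ)) p = poch (-(l : ℂ)) j * poch (-(l : ℂ) - 1 + j + 1) (p - j) := by
    conv_lhs => rw [show p = j + (p - j) by omega, poch_add]
    rw [show -(l : ℂ) - 1 + j + 1 = -(l : ℂ) + j by ring]
  have n1 : poch (-(l : ℂ)) j ≠ 0 := poch_neg_natCast_ne_zero (by omega)
  rw [show (p : ℂ) + (-(l : ℂ) - 1) + (2 * l - 2 * p + 1) + 1 = l - p + 1 by ring,
    show (1 + 2 * α - 1) / 2 = α by ring, e1]
  rw [e1, mul_ne_zero_iff] at h0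
  have := h0.2
  field_simp

/-! ### The action of `gl_n` on polynomials -/

section Gl

attribute [local instance 100] LieRing.ofAssociativeRing

theorem glHom_mul {n : ℕ} (A : Matrix (Fin n) (Fin n) ℂ) (f g : Poly n) :
    glHom n A (f * g) = f * glHom n A g + g * glHom n A f :=
  (glDer A).leibniz f g

theorem glHom_pow {n : ℕ} (A : Matrix (Fin n) (Fin n) ℂ) (f : Poly n) (k : ℕ) :
    glHom n A (f ^ k) = (k : Poly n) * f ^ (k - 1) * glHom n A f := by
  have := (glDer A).leibniz_pow f k
  rw [nsmul_eq_mul, smul_eq_mul, ← mul_assoc] at this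
  exact this

theorem glHom_X {n : ℕ} (A : Matrix (Fin n) (Fin n) ℂ) (j s : Fin n) :
    glHom n A (MvPolynomial.X (j, s)) = ∑ i, A i j • MvPolynomial.X (i, s) :=
  MvPolynomial.mkDerivation_X ℂ (fun js : Fin n × Fin n => ∑ i, A i js.1 •
    (MvPolynomial.X (i, js.2) : Poly n)) (j, s)

theorem glHom_comm {n : ℕ} (A B : Matrix (Fin n) (Fin n) ℂ) (f : Poly n) :
    glHom n A (glHom n B f) = glHom n B (glHom n A f) + glHom n (A * B - B * A) f := by
  have h := LieHom.map_lie (glHom n) A B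
  rw [Ring.lie_def, Ring.lie_def] at h
  rw [h]
  simp

/-- The operators preserving a subspace. -/
def stabilizer {n : ℕ} (N : Submodule ℂ (Poly n)) : Subalgebra ℂ (Module.End ℂ (Poly n)) where
  carrier := {T | ∀ f ∈ N, T f ∈ N}
  mul_mem' := fun {_ _} hS hT f hf => hS _ (hT f hf)
  add_mem' := fun {_ _} hS hT f hf => N.add_mem (hS f hf) (hT f hf)
  algebraMap_mem' := fun c _ hf => N.smul_mem c hf

/-- The action of `gl_n` takes values in the associative algebra `stabilizer N`, so by the universal
property the action of the enveloping algebra factors through it. -/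
theorem uHom_mem_stabilizer {n : ℕ} {N : Submodule ℂ (Poly n)} (hN : GlStable N)
    (u : UniversalEnvelopingAlgebra ℂ (Matrix (Fin n) (Fin n) ℂ)) :
    uHom n u ∈ stabilizer N := by
  let φ : Matrix (Fin n) (Fin n) ℂ →ₗ⁅ℂ⁆ stabilizer N :=
    { toFun := fun A => ⟨glHom n A, hN A⟩
      map_add' := fun A B => Subtype.ext (map_add (glHom n) A B)
      map_smul' := fun c A => Subtype.ext (map_smul (glHom n) c A)
      map_lie' := fun {A B} => Subtype.ext (LieHom.map_lie (glHom n) A B) }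
  have h : uHom n = (stabilizer N).val.comp (UniversalEnvelopingAlgebra.lift ℂ φ) := by
    apply UniversalEnvelopingAlgebra.hom_ext
    ext A : 1
    simp [uHom, φ]
  rw [h]
  exact (UniversalEnvelopingAlgebra.lift ℂ φ u).2

/-! ### The cyclic module as the smallest stable subspace containing its generator. -/

theorem mem_cyclicModule {n l : ℕ} {α : ℂ} {g : Poly n} :
    g ∈ cyclicModule n l α ↔ ∃ u, uHom n u (alphaDet n α ^ l) = g :=
  Iff.rfl

theorem glStable_cyclicModule (n l : ℕ) (α : ℂ) : GlStable (cyclicModule n l α) := by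
  intro A g hg
  obtain ⟨u, rfl⟩ := mem_cyclicModule.1 hg
  exact mem_cyclicModule.2 ⟨UniversalEnvelopingAlgebra.ι ℂ A * u, by simp [uHom]⟩

theorem alphaDet_pow_mem_cyclicModule (n l : ℕ) (α : ℂ) :
    alphaDet n α ^ l ∈ cyclicModule n l α :=
  mem_cyclicModule.2 ⟨1, by simp⟩

theorem cyclicModule_le {n l : ℕ} {α : ℂ} {N : Submodule ℂ (Poly n)} (hN : GlStable N)
    (h : alphaDet n α ^ l ∈ N) : cyclicModule n l α ≤ N := by
  intro g hg
  obtain ⟨u, rfl⟩ := mem_cyclicModule.1 hg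
  exact uHom_mem_stabilizer hN u _ h

theorem GlStable.inf {n : ℕ} {N N' : Submodule ℂ (Poly n)} (hN : GlStable N)
    (hN' : GlStable N') : GlStable (N ⊓ N') :=
  fun A f hf => ⟨hN A f hf.1, hN' A f hf.2⟩

theorem GlStable.iSup {n : ℕ} {ι : Sort*} {N : ι → Submodule ℂ (Poly n)}
    (hN : ∀ i, GlStable (N i)) : GlStable (⨆ i, N i) := by
  intro A
  change (⨆ i, N i) ≤ (⨆ i, N i).comap (glHom n A)
  exact iSup_le fun i f hf => Submodule.mem_iSup_of_mem i (hN i A f hf)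

/-! ### Highest weight modules of `gl_2` -/

/-- The action of `E_12`. -/
def raise : Module.End ℂ (Poly 2) := glHom 2 (Matrix.single 0 1 1)

/-- The action of `E_21`. -/
def lower : Module.End ℂ (Poly 2) := glHom 2 (Matrix.single 1 0 1)

/-- The action of `E_ii`. -/
def wtOp (i : Fin 2) : Module.End ℂ (Poly 2) := glHom 2 (Matrix.single i i 1)

theorem glHom_two (A : Matrix (Fin 2) (Fin 2) ℂ) (f : Poly 2) :
    glHom 2 A f = A 0 0 • wtOp 0 f + A 0 1 • raise f + A 1 0 • lower f + A 1 1 • wtOp 1 f := by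
  have h : A = A 0 0 • Matrix.single 0 0 1 + A 0 1 • Matrix.single 0 1 1 +
      A 1 0 • Matrix.single 1 0 1 + A 1 1 • Matrix.single 1 1 1 := by
    ext i j
    fin_cases i <;> fin_cases j <;> simp [Matrix.single]
  conv_lhs => rw [h]
  simp only [map_add, map_smul, LinearMap.add_apply, LinearMap.smul_apply]
  rfl

theorem glStable_two {N : Submodule ℂ (Poly 2)} (h0 : ∀ f ∈ N, wtOp 0 f ∈ N)
    (h1 : ∀ f ∈ N, wtOp 1 f ∈ N) (hr : ∀ f ∈ N, raise f ∈ N) (hl : ∀ f ∈ N, lower f ∈ N) :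
    GlStable N := by
  intro A f hf
  rw [glHom_two]
  exact N.add_mem (N.add_mem (N.add_mem (N.smul_mem _ (h0 f hf)) (N.smul_mem _ (hr f hf)))
    (N.smul_mem _ (hl f hf))) (N.smul_mem _ (h1 f hf))

theorem wtOp_zero_lower (f : Poly 2) : wtOp 0 (lower f) = lower (wtOp 0 f) - lower f := by
  rw [wtOp, lower, glHom_comm]
  simp [sub_eq_add_neg]

theorem wtOp_one_lower (f : Poly 2) : wtOp 1 (lower f) = lower (wtOp 1 f) + lower f := by
  rw [wtOp, lower, glHom_comm]
  simp

theorem raise_lower (f : Poly 2) : raise (lower f) = lower (raise f) + (wtOp 0 f - wtOp 1 f) := by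
  rw [raise, lower, glHom_comm, wtOp, wtOp, ← LinearMap.sub_apply, ← map_sub]
  simp

/-- `v` is a highest weight vector of weight `(a, b)`, `a - b = n`, killed by `E_21 ^ (n + 1)`. -/
structure IsPrimitive (v : Poly 2) (a b : ℂ) (n : ℕ) : Prop where
  ne_zero : v ≠ 0
  wt_zero : wtOp 0 v = a • v
  wt_one : wtOp 1 v = b • v
  raise_eq : raise v = 0
  sub_eq : a - b = n
  lower_pow : (lower ^ (n + 1)) v = 0

/-- The span of the vectors `E_21 ^ k v`. -/
def lowerSpan (v : Poly 2) : Submodule ℂ (Poly 2) :=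
  Submodule.span ℂ (Set.range fun k : ℕ => (lower ^ k) v)

/-- The Casimir operator `E_21 E_12 + h (h + 1)`, `h = (E_11 - E_22) / 2`. -/
def casimir : Module.End ℂ (Poly 2) :=
  lower * raise + ((2 : ℂ)⁻¹ • (wtOp 0 - wtOp 1)) * ((2 : ℂ)⁻¹ • (wtOp 0 - wtOp 1) + 1)

theorem lower_pow_succ (k : ℕ) (v : Poly 2) : (lower ^ (k + 1)) v = lower ((lower ^ k) v) := by
  rw [pow_succ', Module.End.mul_apply]

namespace IsPrimitive

variable {v : Poly 2} {a b : ℂ} {n : ℕ} (hv : IsPrimitive v a b n)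
include hv

theorem wtOp_zero_lower_pow (k : ℕ) : wtOp 0 ((lower ^ k) v) = (a - k) • (lower ^ k) v := by
  induction k with
  | zero => simpa using hv.wt_zero
  | succ k ih =>
    rw [lower_pow_succ, wtOp_zero_lower, ih, map_smul, ← one_smul ℂ (lower ((lower ^ k) v)),
      smul_smul, ← sub_smul]
    simp
    ring_nf

theorem wtOp_one_lower_pow (k : ℕ) : wtOp 1 ((lower ^ k) v) = (b + k) • (lower ^ k) v := by
  induction k with
  | zero => simpa using hv.wt_one
  | succ k ih =>
    rw [lower_pow_succ, wtOp_one_lower, ih, map_smul, ← one_smul ℂ (lower ((lower ^ k) v)),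
      smul_smul, ← add_smul]
    simp
    ring_nf

/-- Induction through `[E_12, E_21] = E_11 - E_22`. The factor is nonzero for `k < n`, which is what
drives the irreducibility. -/
theorem raise_lower_pow_succ (k : ℕ) :
    raise ((lower ^ (k + 1)) v) = (((k : ℂ) + 1) * (n - k)) • (lower ^ k) v := by
  induction k with
  | zero => simp [raise_lower, hv.raise_eq, hv.wt_zero, hv.wt_one, ← sub_smul, hv.sub_eq]
  | succ k ih =>
    rw [lower_pow_succ (k + 1), raise_lower, ih, hv.wtOp_zero_lower_pow, hv.wtOp_one_lower_pow,
      map_smul, ← lower_pow_succ, ← sub_smul, ← add_smul, ← hv.sub_eq]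
    congr 1
    push_cast
    ring

theorem lower_pow_eq_zero {k : ℕ} (hk : n < k) : (lower ^ k) v = 0 := by
  obtain ⟨d, rfl⟩ := Nat.exists_eq_add_of_le (show n + 1 ≤ k from hk)
  rw [add_comm, pow_add, Module.End.mul_apply, hv.lower_pow, map_zero]

theorem glStable_lowerSpan : GlStable (lowerSpan v) := by
  have key : ∀ T : Module.End ℂ (Poly 2), (∀ k, T ((lower ^ k) v) ∈ lowerSpan v) →
      ∀ f ∈ lowerSpan v, T f ∈ lowerSpan v := by
    intro T hT
    change lowerSpan v ≤ (lowerSpan v).comap T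
    rw [lowerSpan, Submodule.span_le]
    rintro _ ⟨k, rfl⟩
    exact hT k
  have mem : ∀ k, (lower ^ k) v ∈ lowerSpan v := fun k => Submodule.subset_span ⟨k, rfl⟩
  refine glStable_two (key _ fun k => ?_) (key _ fun k => ?_) (key _ fun k => ?_)
    (key _ fun k => ?_)
  · rw [hv.wtOp_zero_lower_pow]
    exact Submodule.smul_mem _ _ (mem k)
  · rw [hv.wtOp_one_lower_pow]
    exact Submodule.smul_mem _ _ (mem k)
  · cases k with
    | zero => simp [hv.raise_eq]
    | succ k =>
      rw [hv.raise_lower_pow_succ]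
      exact Submodule.smul_mem _ _ (mem k)
  · rw [← lower_pow_succ]
    exact mem _

/-- `E_21 E_12` contributes `k (n - k + 1)` and `h` acts by `n / 2 - k`; the dependence on `k`
cancels. -/
theorem casimir_lower_pow (k : ℕ) :
    casimir ((lower ^ k) v) = ((n : ℂ) / 2 * (n / 2 + 1)) • (lower ^ k) v := by
  have h1 : lower (raise ((lower ^ k) v)) = ((k : ℂ) * (n - k + 1)) • (lower ^ k) v := by
    cases k with
    | zero => simp [hv.raise_eq]
    | succ k =>
      rw [hv.raise_lower_pow_succ, map_smul, ← lower_pow_succ]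
      congr 1
      push_cast
      ring
  have h2 : ((2 : ℂ)⁻¹ • (wtOp 0 - wtOp 1)) ((lower ^ k) v) =
      ((n : ℂ) / 2 - k) • (lower ^ k) v := by
    rw [LinearMap.smul_apply, LinearMap.sub_apply, hv.wtOp_zero_lower_pow, hv.wtOp_one_lower_pow,
      ← sub_smul, smul_smul, ← hv.sub_eq]
    congr 1
    ring
  rw [casimir, LinearMap.add_apply, Module.End.mul_apply, Module.End.mul_apply,
    LinearMap.add_apply, map_add, Module.End.one_apply, h1, h2, map_smul, h2, smul_smul, ← add_smul,
    ← add_smul]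
  congr 1
  ring

theorem lowerSpan_le_eigenspace :
    lowerSpan v ≤ casimir.eigenspace ((n : ℂ) / 2 * (n / 2 + 1)) := by
  rw [lowerSpan, Submodule.span_le]
  rintro _ ⟨k, rfl⟩
  exact Module.End.mem_eigenspace_iff.2 (hv.casimir_lower_pow k)

theorem exists_raise_pow_lower_pow {k : ℕ} (hk : k ≤ n) :
    ∃ c : ℂ, c ≠ 0 ∧ (raise ^ k) ((lower ^ k) v) = c • v := by
  induction k with
  | zero => exact ⟨1, one_ne_zero, by simp⟩
  | succ k ih =>
    obtain ⟨c, hc, h⟩ := ih (by omega)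
    refine ⟨((k : ℂ) + 1) * (n - k) * c, ?_, ?_⟩
    · have h1 : (k : ℂ) + 1 ≠ 0 := by exact_mod_cast k.succ_ne_zero
      have h2 : (n : ℂ) - k ≠ 0 := sub_ne_zero.2 (by exact_mod_cast (show n ≠ k by omega))
      exact mul_ne_zero (mul_ne_zero h1 h2) hc
    · rw [pow_succ, Module.End.mul_apply, hv.raise_lower_pow_succ, map_smul, h, smul_smul]

theorem lower_pow_ne_zero {k : ℕ} (hk : k ≤ n) : (lower ^ k) v ≠ 0 := by
  intro h
  obtain ⟨c, hc, h'⟩ := hv.exists_raise_pow_lower_pow hk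
  rw [h, map_zero, eq_comm, smul_eq_zero] at h'
  exact h'.elim hc hv.ne_zero

theorem raise_pow_lower_pow_of_lt {j k : ℕ} (hk : k ≤ n) (hj : k < j) :
    (raise ^ j) ((lower ^ k) v) = 0 := by
  obtain ⟨d, rfl⟩ := Nat.exists_eq_add_of_le (show k + 1 ≤ j from hj)
  obtain ⟨c, -, h⟩ := hv.exists_raise_pow_lower_pow hk
  rw [show k + 1 + d = d + 1 + k by omega, pow_add, Module.End.mul_apply, h, map_smul, pow_succ,
    Module.End.mul_apply, hv.raise_eq, map_zero, smul_zero]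

theorem exists_eq_sum {f : Poly 2} (hf : f ∈ lowerSpan v) :
    ∃ c : ℕ → ℂ, f = ∑ k ∈ Finset.range (n + 1), c k • (lower ^ k) v := by
  induction hf using Submodule.span_induction with
  | mem x hx =>
    obtain ⟨k, rfl⟩ := hx
    by_cases hk : k ≤ n
    · refine ⟨Pi.single k 1, ?_⟩
      rw [Finset.sum_eq_single k]
      · simp
      · intro j _ hj
        simp [hj]
      · intro h
        simp at h
        omega
    · refine ⟨0, ?_⟩
      simp [hv.lower_pow_eq_zero (show n < k by omega)]
  | zero => exact ⟨0, by simp⟩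
  | add x y _ _ hx hy =>
    obtain ⟨c, rfl⟩ := hx
    obtain ⟨d, rfl⟩ := hy
    exact ⟨c + d, by simp [add_smul, Finset.sum_add_distrib]⟩
  | smul r x _ hx =>
    obtain ⟨c, rfl⟩ := hx
    exact ⟨r • c, by simp [Finset.smul_sum, smul_smul]⟩

/-- Induction on the length. If the top coefficient is nonzero, `E_12 ^ j` kills all the lower terms
and sends the top one to a nonzero multiple of `v`. -/
theorem mem_of_sum_mem {N : Submodule ℂ (Poly 2)} (hN : ∀ f ∈ N, raise f ∈ N) (c : ℕ → ℂ)
    {j : ℕ} (hj : j ≤ n + 1) (hmem : ∑ k ∈ Finset.range j, c k • (lower ^ k) v ∈ N)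
    (hne : ∑ k ∈ Finset.range j, c k • (lower ^ k) v ≠ 0) : v ∈ N := by
  induction j with
  | zero => simp at hne
  | succ j ih =>
    by_cases hc : c j = 0
    · rw [Finset.sum_range_succ, hc, zero_smul, add_zero] at hmem hne
      exact ih (by omega) hmem hne
    · have hpow : ∀ i, ∀ f ∈ N, (raise ^ i) f ∈ N := by
        intro i
        induction i with
        | zero => simp
        | succ i ih' =>
          intro f hf
          rw [pow_succ, Module.End.mul_apply]
          exact ih' _ (hN f hf)
      have h := hpow j _ hmem
      obtain ⟨d, hd, h'⟩ := hv.exists_raise_pow_lower_pow (show j ≤ n by omega)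
      rw [map_sum, Finset.sum_range_succ, Finset.sum_eq_zero, zero_add, map_smul, h',
        smul_smul] at h
      · exact (N.smul_mem_iff (mul_ne_zero hc hd)).1 h
      · intro k hk
        rw [Finset.mem_range] at hk
        rw [map_smul, hv.raise_pow_lower_pow_of_lt (by omega) hk, smul_zero]

theorem isIrredOfHighestWeight : IsIrredOfHighestWeight (lowerSpan v) ![a, b] where
  stable := hv.glStable_lowerSpan
  ne_bot := by
    intro h
    have : v ∈ lowerSpan v := Submodule.subset_span ⟨0, by simp⟩
    rw [h, Submodule.mem_bot] at this
    exact hv.ne_zero this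
  irred := by
    intro N' hle hst
    refine or_iff_not_imp_left.2 fun hne => le_antisymm hle ?_
    obtain ⟨f, hf, hf0⟩ := Submodule.exists_mem_ne_zero_of_ne_bot hne
    obtain ⟨c, rfl⟩ := hv.exists_eq_sum (hle hf)
    have hvN := hv.mem_of_sum_mem (fun g hg => hst _ g hg) c le_rfl hf hf0
    rw [lowerSpan, Submodule.span_le]
    rintro _ ⟨k, rfl⟩
    induction k with
    | zero => simpa using hvN
    | succ k ih =>
      simp only [SetLike.mem_coe] at ih ⊢
      rw [lower_pow_succ]
      exact hst _ _ ih
  exists_highest := by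
    refine ⟨v, Submodule.subset_span ⟨0, by simp⟩, hv.ne_zero, ?_, ?_⟩
    · intro i
      fin_cases i
      · exact hv.wt_zero
      · exact hv.wt_one
    · intro i j hij
      fin_cases i <;> fin_cases j <;> simp at hij
      exact hv.raise_eq

end IsPrimitive

end Gl

/-! ### Highest weight vectors and the zero weight space in `ℂ[x_11, x_12, x_21, x_22]` -/

section Concrete

attribute [local instance 100] LieRing.ofAssociativeRing

open MvPolynomial in
/-- The determinant of `X = (x_ij)`. -/
def detX : Poly 2 := X (0, 0) * X (1, 1) - X (0, 1) * X (1, 0)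

open MvPolynomial in
/-- The product `x_11 x_12`. -/
def topX : Poly 2 := X (0, 0) * X (0, 1)

open MvPolynomial in
/-- The product `x_11 x_22`. -/
def diagX : Poly 2 := X (0, 0) * X (1, 1)

open MvPolynomial in
/-- The product `x_12 x_21`. -/
def antiX : Poly 2 := X (0, 1) * X (1, 0)

open MvPolynomial in
/-- The product `x_21 x_22`. -/
def botX : Poly 2 := X (1, 0) * X (1, 1)

theorem raise_X (j s : Fin 2) : raise (MvPolynomial.X (j, s)) =
    if j = 1 then MvPolynomial.X (0, s) else 0 := by
  rw [raise, glHom_X]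
  fin_cases j <;> simp [Matrix.single]

theorem lower_X (j s : Fin 2) : lower (MvPolynomial.X (j, s)) =
    if j = 0 then MvPolynomial.X (1, s) else 0 := by
  rw [lower, glHom_X]
  fin_cases j <;> simp [Matrix.single]

theorem wtOp_X (i j s : Fin 2) : wtOp i (MvPolynomial.X (j, s)) =
    if j = i then MvPolynomial.X (j, s) else 0 := by
  rw [wtOp, glHom_X]
  fin_cases j <;> fin_cases i <;> simp [Matrix.single]

theorem raise_mul (f g : Poly 2) : raise (f * g) = f * raise g + g * raise f := glHom_mul _ f g

theorem lower_mul (f g : Poly 2) : lower (f * g) = f * lower g + g * lower f := glHom_mul _ f g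

theorem wtOp_mul (i : Fin 2) (f g : Poly 2) : wtOp i (f * g) = f * wtOp i g + g * wtOp i f :=
  glHom_mul _ f g

theorem raise_pow (f : Poly 2) (k : ℕ) : raise (f ^ k) = (k : Poly 2) * f ^ (k - 1) * raise f :=
  glHom_pow _ f k

theorem lower_pow (f : Poly 2) (k : ℕ) : lower (f ^ k) = (k : Poly 2) * f ^ (k - 1) * lower f :=
  glHom_pow _ f k

theorem wtOp_pow (i : Fin 2) (f : Poly 2) (k : ℕ) :
    wtOp i (f ^ k) = (k : Poly 2) * f ^ (k - 1) * wtOp i f :=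
  glHom_pow _ f k

theorem natCast_mul_pow_pred_mul (f : Poly 2) (k : ℕ) :
    (k : Poly 2) * f ^ (k - 1) * f = (k : ℂ) • f ^ k := by
  cases k with
  | zero => simp
  | succ k => rw [mul_assoc, ← pow_succ, Nat.succ_sub_one, MvPolynomial.smul_eq_C_mul]; simp

theorem lower_detX : lower detX = 0 := by
  simp [detX, lower_mul, lower_X]
  ring

theorem raise_detX : raise detX = 0 := by
  simp [detX, raise_mul, raise_X]
  ring

theorem wtOp_detX (i : Fin 2) : wtOp i detX = detX := by
  fin_cases i
  · simp [detX, wtOp_mul, wtOp_X]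
    ring
  · simp [detX, wtOp_mul, wtOp_X]

theorem raise_topX : raise topX = 0 := by
  simp [topX, raise_mul, raise_X]

theorem wtOp_zero_topX : wtOp 0 topX = (2 : ℂ) • topX := by
  rw [two_smul]
  simp [topX, wtOp_mul, wtOp_X]
  ring

theorem wtOp_one_topX : wtOp 1 topX = 0 := by
  simp [topX, wtOp_mul, wtOp_X]

/-- In the Leibniz expansion every term `E_21^i f · E_21^(n-i) g` has `i ≥ a` or `n - i ≥ b`,
because `a + b ≤ n + 1`. The induction applies the product rule once at a time. -/
theorem lower_pow_mul_eq_zero (n : ℕ) : ∀ (f g : Poly 2) (a b : ℕ), (lower ^ a) f = 0 →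
    (lower ^ b) g = 0 → a + b ≤ n + 1 → (lower ^ n) (f * g) = 0 := by
  induction n with
  | zero =>
    intro f g a b hf hg hab
    rcases Nat.eq_zero_or_pos a with rfl | ha
    · simp at hf; simp [hf]
    · obtain rfl : b = 0 := by omega
      simp at hg; simp [hg]
  | succ n ih =>
    intro f g a b hf hg hab
    rcases a with _ | a
    · simp at hf; simp [hf]
    rcases b with _ | b
    · simp at hg; simp [hg]
    rw [pow_succ, Module.End.mul_apply] at hf hg ⊢
    rw [lower_mul, map_add, ih f (lower g) (a + 1) b (by rwa [pow_succ]) hg (by omega),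
      ih g (lower f) (b + 1) a (by rwa [pow_succ]) hf (by omega), add_zero]

theorem lower_pow_detX_pow_mul (s k : ℕ) (f : Poly 2) :
    (lower ^ k) (detX ^ s * f) = detX ^ s * (lower ^ k) f := by
  induction k with
  | zero => simp
  | succ k ih =>
    rw [lower_pow_succ, ih, lower_mul, lower_pow, lower_detX, mul_zero, mul_zero, add_zero,
      lower_pow_succ]

theorem lower_pow_topX_pow (m : ℕ) : (lower ^ (2 * m + 1)) (topX ^ m) = 0 := by
  induction m with
  | zero => simpa using lower_pow (1 : Poly 2) 0
  | succ m ih =>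
    rw [pow_succ]
    refine lower_pow_mul_eq_zero (2 * (m + 1) + 1) _ _ (2 * m + 1) 3 ih ?_ (by omega)
    simp [topX, pow_succ, lower_mul, lower_X]

theorem detX_ne_zero : detX ≠ 0 := by
  intro h
  have := congrArg (MvPolynomial.eval fun x => if x.1 = x.2 then (1 : ℂ) else 0) h
  simp [detX] at this

theorem topX_ne_zero : topX ≠ 0 :=
  mul_ne_zero (MvPolynomial.X_ne_zero _) (MvPolynomial.X_ne_zero _)

/-- The highest weight vector `det(X) ^ s (x_11 x_12) ^ m`. -/
theorem isPrimitive (s m : ℕ) :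
    IsPrimitive (detX ^ s * topX ^ m) (s + 2 * m) s (2 * m) where
  ne_zero := mul_ne_zero (pow_ne_zero _ detX_ne_zero) (pow_ne_zero _ topX_ne_zero)
  wt_zero := by
    rw [wtOp_mul, wtOp_pow, wtOp_pow, wtOp_detX, wtOp_zero_topX, mul_smul_comm,
      natCast_mul_pow_pred_mul, natCast_mul_pow_pred_mul]
    simp only [MvPolynomial.smul_eq_C_mul, map_add, map_mul]
    ring
  wt_one := by
    rw [wtOp_mul, wtOp_pow, wtOp_pow, wtOp_detX, wtOp_one_topX, natCast_mul_pow_pred_mul]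
    simp only [MvPolynomial.smul_eq_C_mul]
    ring
  raise_eq := by
    rw [raise_mul, raise_pow, raise_pow, raise_detX, raise_topX]
    simp
  sub_eq := by push_cast; ring
  lower_pow := by rw [lower_pow_detX_pow_mul, lower_pow_topX_pow, mul_zero]

open MvPolynomial in
/-- The span of the monomials of degree `l` in both columns and of degree `k` in the second row. -/
def gridSub (l k : ℕ) : Submodule ℂ (Poly 2) :=
  Submodule.span ℂ {f | ∃ a b c d : ℕ, a + c = l ∧ b + d = l ∧ c + d = k ∧
    f = X (0, 0) ^ a * X (0, 1) ^ b * X (1, 0) ^ c * X (1, 1) ^ d}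

theorem mul_mem_gridSub {l l' k k' : ℕ} {f g : Poly 2} (hf : f ∈ gridSub l k)
    (hg : g ∈ gridSub l' k') : f * g ∈ gridSub (l + l') (k + k') := by
  have h := Submodule.mul_mem_mul hf hg
  rw [gridSub, gridSub, Submodule.span_mul_span] at h
  refine Submodule.span_mono ?_ h
  rintro _ ⟨_, ⟨a, b, c, d, h1, h2, h3, rfl⟩, _, ⟨a', b', c', d', h1', h2', h3', rfl⟩, rfl⟩
  refine ⟨a + a', b + b', c + c', d + d', by omega, by omega, by omega, ?_⟩
  simp only [pow_add]
  ring

theorem one_mem_gridSub : (1 : Poly 2) ∈ gridSub 0 0 :=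
  Submodule.subset_span ⟨0, 0, 0, 0, rfl, rfl, rfl, by simp⟩

theorem pow_mem_gridSub {l k : ℕ} {f : Poly 2} (hf : f ∈ gridSub l k) (n : ℕ) :
    f ^ n ∈ gridSub (n * l) (n * k) := by
  induction n with
  | zero => simpa using one_mem_gridSub
  | succ n ih =>
    rw [pow_succ, add_mul, add_mul, one_mul, one_mul]
    exact mul_mem_gridSub ih hf

theorem diagX_mem : diagX ∈ gridSub 1 1 :=
  Submodule.subset_span ⟨1, 0, 0, 1, rfl, rfl, rfl, by simp [diagX]⟩

theorem antiX_mem : antiX ∈ gridSub 1 1 :=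
  Submodule.subset_span ⟨0, 1, 1, 0, rfl, rfl, rfl, by simp [antiX]⟩

theorem detX_mem : detX ∈ gridSub 1 1 :=
  sub_mem diagX_mem antiX_mem

theorem topX_mem : topX ∈ gridSub 1 0 :=
  Submodule.subset_span ⟨1, 1, 0, 0, rfl, rfl, rfl, by simp [topX]⟩

theorem lower_mem_gridSub {l k : ℕ} {f : Poly 2} (hf : f ∈ gridSub l k) :
    lower f ∈ gridSub l (k + 1) := by
  revert f
  change gridSub l k ≤ (gridSub l (k + 1)).comap lower
  rw [gridSub, Submodule.span_le]
  rintro _ ⟨a, b, c, d, h1, h2, h3, rfl⟩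
  simp only [SetLike.mem_coe, Submodule.mem_comap]
  have h : lower (MvPolynomial.X (0, 0) ^ a * MvPolynomial.X (0, 1) ^ b *
      MvPolynomial.X (1, 0) ^ c * MvPolynomial.X (1, 1) ^ d) =
      (a : ℂ) • (MvPolynomial.X (0, 0) ^ (a - 1) * MvPolynomial.X (0, 1) ^ b *
        MvPolynomial.X (1, 0) ^ (c + 1) * MvPolynomial.X (1, 1) ^ d) +
      (b : ℂ) • (MvPolynomial.X (0, 0) ^ a * MvPolynomial.X (0, 1) ^ (b - 1) *
        MvPolynomial.X (1, 0) ^ c * MvPolynomial.X (1, 1) ^ (d + 1)) := by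
    simp [lower_mul, lower_pow, lower_X, MvPolynomial.smul_eq_C_mul]
    ring
  rw [h]
  refine add_mem ?_ ?_
  · rcases a with _ | a
    · simp
    · exact Submodule.smul_mem _ _ (Submodule.subset_span
        ⟨a, b, c + 1, d, by omega, by omega, by omega, by simp⟩)
  · rcases b with _ | b
    · simp
    · exact Submodule.smul_mem _ _ (Submodule.subset_span
        ⟨a, b, c, d + 1, by omega, by omega, by omega, by simp⟩)

theorem lower_pow_mem_gridSub {l k : ℕ} {f : Poly 2} (hf : f ∈ gridSub l k) (n : ℕ) :
    (lower ^ n) f ∈ gridSub l (k + n) := by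
  induction n with
  | zero => simpa using hf
  | succ n ih =>
    rw [lower_pow_succ]
    exact lower_mem_gridSub ih

/-- When all row and column degrees equal `l`, the exponents satisfy `a = d` and `b = c`. The
resulting `l + 1` generators bound the dimension. -/
theorem gridSub_eq_span (l : ℕ) : gridSub l l =
    Submodule.span ℂ (Set.range fun j : Fin (l + 1) => diagX ^ (l - (j : ℕ)) * antiX ^ (j : ℕ)) := by
  rw [gridSub]
  congr 1
  ext f
  constructor
  · rintro ⟨a, b, c, d, h1, h2, h3, rfl⟩
    obtain rfl : d = a := by omega
    obtain rfl : b = c := by omega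
    refine ⟨⟨b, by omega⟩, ?_⟩
    simp only [diagX, antiX, mul_pow, show l - b = d by omega]
    ring
  · rintro ⟨⟨j, hj⟩, rfl⟩
    refine ⟨l - j, j, j, l - j, by omega, by omega, by omega, ?_⟩
    simp only [diagX, antiX, mul_pow]
    ring

/-- With `a = l - j` and `c = j`, the three coefficients are those on the left of `hahn_difference`.
-/
theorem raise_lower_diagX_antiX (a c : ℕ) : raise (lower (diagX ^ a * antiX ^ c)) =
    ((a : ℂ) ^ 2) • (diagX ^ (a - 1) * antiX ^ (c + 1)) +
      ((a : ℂ) + c + 2 * a * c) • (diagX ^ a * antiX ^ c) +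
      ((c : ℂ) ^ 2) • (diagX ^ (a + 1) * antiX ^ (c - 1)) := by
  have e1 : lower diagX = botX := by simp [diagX, botX, lower_mul, lower_X, mul_comm]
  have e2 : lower antiX = botX := by simp [antiX, botX, lower_mul, lower_X, mul_comm]
  have e3 : raise diagX = topX := by simp [diagX, topX, raise_mul, raise_X]
  have e4 : raise antiX = topX := by simp [antiX, topX, raise_mul, raise_X, mul_comm]
  have e5 : raise botX = diagX + antiX := by
    simp [botX, diagX, antiX, raise_mul, raise_X]; ring
  have e7 : ∀ k : ℕ, raise (k : Poly 2) = 0 := fun k => (glDer _).map_natCast k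
  simp only [lower_mul, lower_pow, raise_mul, map_add, raise_pow, e1, e2, e3, e4, e5, e7,
    MvPolynomial.smul_eq_C_mul, map_mul, map_natCast, map_pow, map_ofNat]
  -- Two derivatives produce exponents truncated at `0`; separating `0`, `1` and larger values shows
  -- that such terms have coefficient zero.
  rcases a with _ | _ | a <;> rcases c with _ | _ | c <;>
    simp only [Nat.cast_zero, Nat.cast_add, Nat.cast_one, zero_add, add_tsub_cancel_right,
      pow_zero, zero_mul, mul_zero, add_zero, mul_one, one_mul, pow_succ,
      show (0 - 1 : ℕ) = 0 from rfl]
  all_goals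
    simp only [botX, topX, diagX, antiX]
    ring

end Concrete

section Decomposition

attribute [local instance 100] LieRing.ofAssociativeRing

/-! ### The zero weight vectors -/

theorem wtOp_diagX_antiX (i : Fin 2) (a c : ℕ) :
    wtOp i (diagX ^ a * antiX ^ c) = ((a : ℂ) + c) • (diagX ^ a * antiX ^ c) := by
  have e1 : wtOp i diagX = diagX := by
    fin_cases i
    · simp [diagX, wtOp_mul, wtOp_X, mul_comm]
    · simp [diagX, wtOp_mul, wtOp_X]
  have e2 : wtOp i antiX = antiX := by
    fin_cases i
    · simp [antiX, wtOp_mul, wtOp_X, mul_comm]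
    · simp [antiX, wtOp_mul, wtOp_X]
  rw [wtOp_mul, wtOp_pow, wtOp_pow, e1, e2, natCast_mul_pow_pred_mul, natCast_mul_pow_pred_mul]
  simp only [MvPolynomial.smul_eq_C_mul, map_add]
  ring

/-- Both weights of these monomials agree, so `h = 0` and the Casimir operator reduces to `E_21 E_12
= E_12 E_21`. -/
theorem casimir_diagX_antiX (a c : ℕ) : casimir (diagX ^ a * antiX ^ c) =
    ((a : ℂ) ^ 2) • (diagX ^ (a - 1) * antiX ^ (c + 1)) +
      ((a : ℂ) + c + 2 * a * c) • (diagX ^ a * antiX ^ c) +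
      ((c : ℂ) ^ 2) • (diagX ^ (a + 1) * antiX ^ (c - 1)) := by
  rw [← raise_lower_diagX_antiX, raise_lower]
  simp [casimir, wtOp_diagX_antiX]

/-- The substitution `x_12 ↦ t`, `x_11, x_21, x_22 ↦ 1`. -/
def toUnivariate : Poly 2 →ₐ[ℂ] Polynomial ℂ :=
  MvPolynomial.aeval fun x => if x = (0, 1) then Polynomial.X else 1

theorem toUnivariate_diagX_antiX (a c : ℕ) :
    toUnivariate (diagX ^ a * antiX ^ c) = Polynomial.X ^ c := by
  simp [toUnivariate, diagX, antiX]

/-- The linear functional with value `Q_s(j)` at `(x_11 x_22) ^ (l - j) (x_12 x_21) ^ j`. -/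
def hahnFunctional (l s : ℕ) : Poly 2 →ₗ[ℂ] ℂ :=
  ∑ j ∈ Finset.range (l + 1), hahn s j (-(l : ℂ) - 1) (-(l : ℂ) - 1) l •
    (Polynomial.lcoeff ℂ j).comp toUnivariate.toLinearMap

theorem hahnFunctional_apply {l s a c : ℕ} (h : c ≤ l) :
    hahnFunctional l s (diagX ^ a * antiX ^ c) =
      hahn s c (-(l : ℂ) - 1) (-(l : ℂ) - 1) l := by
  rw [hahnFunctional, LinearMap.sum_apply, Finset.sum_eq_single c]
  · simp [-map_mul, -map_pow, toUnivariate_diagX_antiX]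
  · intro j _ hj
    simp [-map_mul, -map_pow, toUnivariate_diagX_antiX, Polynomial.coeff_X_pow, hj]
  · intro h'
    simp at h'
    omega

/-- This is the Hahn difference equation transposed: the functional is an eigenvector for the
adjoint of the Casimir operator. -/
theorem hahnFunctional_casimir {l s : ℕ} (hs : s ≤ l) {f : Poly 2} (hf : f ∈ gridSub l l) :
    hahnFunctional l s (casimir f) = ((l : ℂ) - s) * (l - s + 1) * hahnFunctional l s f := by
  rw [gridSub_eq_span] at hf
  induction hf using Submodule.span_induction with
  | mem x hx =>
    obtain ⟨⟨j, hj⟩, rfl⟩ := hx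
    have hj' : j ≤ l := by omega
    simp only
    rw [casimir_diagX_antiX, hahnFunctional_apply hj', ← hahn_difference l s j hs, map_add,
      map_add, map_smul, map_smul, map_smul, hahnFunctional_apply hj',
      hahnFunctional_apply (show j - 1 ≤ l by omega), Nat.cast_sub hj']
    -- At `j = l` the monomial is outside the range where the functional is known, but its
    -- coefficient vanishes.
    have : ((l : ℂ) - j) ^ 2 • hahnFunctional l s (diagX ^ (l - j - 1) * antiX ^ (j + 1)) =
        ((l : ℂ) - j) ^ 2 * hahn s (j + 1 : ℕ) (-(l : ℂ) - 1) (-(l : ℂ) - 1) l := by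
      rcases hj'.eq_or_lt with rfl | hlt
      · simp
      · rw [hahnFunctional_apply (show j + 1 ≤ l by omega), smul_eq_mul]
    rw [this]
    simp only [smul_eq_mul]
    ring
  | zero => simp
  | add x y _ _ hx hy => rw [map_add, map_add, hx, hy, map_add]; ring
  | smul c x _ hx => rw [map_smul, map_smul, hx, map_smul, smul_eq_mul, smul_eq_mul]; ring

/-- The zero weight vector in the irreducible module of highest weight `(2l - s, s)`. -/
def zeroWeightVector (l s : ℕ) : Poly 2 :=
  (lower ^ (l - s)) (detX ^ s * topX ^ (l - s))

theorem zeroWeightVector_mem {l s : ℕ} (hs : s ≤ l) : zeroWeightVector l s ∈ gridSub l l := by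
  have h := lower_pow_mem_gridSub
    (mul_mem_gridSub (pow_mem_gridSub detX_mem s) (pow_mem_gridSub topX_mem (l - s))) (l - s)
  rwa [mul_one, mul_one, mul_zero, add_zero, show s + (l - s) = l by omega] at h

theorem zeroWeightVector_ne_zero (l s : ℕ) : zeroWeightVector l s ≠ 0 :=
  (isPrimitive s (l - s)).lower_pow_ne_zero (by omega)

theorem casimir_zeroWeightVector {l s : ℕ} (hs : s ≤ l) : casimir (zeroWeightVector l s) =
    (((l : ℂ) - s) * (l - s + 1)) • zeroWeightVector l s := by
  rw [zeroWeightVector, (isPrimitive s (l - s)).casimir_lower_pow]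
  congr 1
  push_cast [hs]
  ring

theorem casimir_eigenvalue_injOn {l s t : ℕ} (hs : s ≤ l) (ht : t ≤ l)
    (h : ((l : ℂ) - s) * (l - s + 1) = ((l : ℂ) - t) * (l - t + 1)) : s = t := by
  rw [← Nat.cast_sub hs, ← Nat.cast_sub ht] at h
  have h' : (l - s) * (l - s + 1) = (l - t) * (l - t + 1) := by exact_mod_cast h
  have : l - s = l - t := by
    rcases lt_trichotomy (l - s) (l - t) with h1 | h1 | h1
    · nlinarith
    · exact h1
    · nlinarith
  omega

theorem linearIndependent_zeroWeightVector (l : ℕ) :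
    LinearIndependent ℂ fun s : Fin (l + 1) => zeroWeightVector l s := by
  refine Module.End.eigenvectors_linearIndependent' casimir
    (fun s : Fin (l + 1) => ((l : ℂ) - (s : ℕ)) * (l - (s : ℕ) + 1)) ?_ _ fun s => ?_
  · intro s t h
    exact Fin.ext (casimir_eigenvalue_injOn (by omega) (by omega) h)
  · exact ⟨Module.End.mem_eigenspace_iff.2 (casimir_zeroWeightVector (by omega)),
      zeroWeightVector_ne_zero _ _⟩

/-- Eigenvectors for distinct eigenvalues are independent, and there are `l + 1` of them in a space
with `l + 1` generators. -/
theorem span_zeroWeightVector (l : ℕ) :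
    Submodule.span ℂ (Set.range fun s : Fin (l + 1) => zeroWeightVector l s) = gridSub l l := by
  have hfin : Module.Finite ℂ (gridSub l l) := by
    rw [gridSub_eq_span]
    exact Module.Finite.span_of_finite ℂ (Set.finite_range _)
  refine Submodule.eq_of_le_of_finrank_le ?_ ?_
  · rw [Submodule.span_le]
    rintro _ ⟨s, rfl⟩
    exact zeroWeightVector_mem (by omega)
  · rw [finrank_span_eq_card (linearIndependent_zeroWeightVector l), gridSub_eq_span]
    exact (finrank_range_le_card _)

theorem hahnFunctional_zeroWeightVector_of_ne {l s t : ℕ} (hs : s ≤ l) (ht : t ≤ l) (h : s ≠ t) :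
    hahnFunctional l s (zeroWeightVector l t) = 0 := by
  have h1 := hahnFunctional_casimir hs (zeroWeightVector_mem ht)
  rw [casimir_zeroWeightVector ht, map_smul, smul_eq_mul] at h1
  by_contra h2
  exact h (casimir_eigenvalue_injOn hs ht (mul_right_cancel₀ h2 h1).symm)

theorem hahnFunctional_sum {l : ℕ} (s : Fin (l + 1)) (a : Fin (l + 1) → ℂ) :
    hahnFunctional l s (∑ t, a t • zeroWeightVector l t) =
      a s * hahnFunctional l s (zeroWeightVector l s) := by
  rw [map_sum, Finset.sum_eq_single s]
  · simp
  · intro t _ ht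
    rw [map_smul, hahnFunctional_zeroWeightVector_of_ne (by omega) (by omega)
      (fun h => ht (Fin.ext h.symm)), smul_zero]
  · simp

/-- Otherwise the functional would vanish on the whole space, whereas its value at `(x_11 x_22)^l`
is `Q_s(0) = 1`. -/
theorem hahnFunctional_zeroWeightVector_ne_zero {l : ℕ} (s : Fin (l + 1)) :
    hahnFunctional l s (zeroWeightVector l s) ≠ 0 := by
  intro h
  have hmem : diagX ^ l * antiX ^ 0 ∈ gridSub l l := by
    rw [gridSub_eq_span]
    exact Submodule.subset_span ⟨0, by simp⟩
  rw [← span_zeroWeightVector] at hmem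
  obtain ⟨a, ha⟩ := (Submodule.mem_span_range_iff_exists_fun ℂ).1 hmem
  have h1 := hahnFunctional_sum s a
  rw [ha, h, mul_zero, hahnFunctional_apply (Nat.zero_le l), Nat.cast_zero,
    hahn_zero l s (by omega)] at h1
  exact one_ne_zero h1

/-! ### The cyclic module -/

theorem alphaDet_two (α : ℂ) : alphaDet 2 α = diagX + MvPolynomial.C α * antiX := by
  have hu : (Finset.univ : Finset (Equiv.Perm (Fin 2))) = {1, Equiv.swap 0 1} := by decide
  have h1 : nu (1 : Equiv.Perm (Fin 2)) = 0 := by simp [nu]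
  have h2 : nu (Equiv.swap (0 : Fin 2) 1) = 1 := by
    have h : (Equiv.swap (0 : Fin 2) 1).IsSwap := ⟨0, 1, by decide, rfl⟩
    simp [nu, Equiv.Perm.IsSwap.isCycle h |>.cycleType]
  rw [alphaDet, hu, Finset.sum_pair (by decide), h1, h2]
  simp [diagX, antiX, mul_comm]

theorem alphaDet_two_pow (l : ℕ) (α : ℂ) : alphaDet 2 α ^ l =
    ∑ j ∈ Finset.range (l + 1), ((l.choose j : ℂ) * α ^ j) • (diagX ^ (l - j) * antiX ^ j) := by
  rw [alphaDet_two, add_comm, add_pow]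
  refine Finset.sum_congr rfl fun j _ => ?_
  simp only [MvPolynomial.smul_eq_C_mul, map_mul, map_pow, map_natCast, mul_pow]
  ring

theorem alphaDet_two_pow_mem (l : ℕ) (α : ℂ) : alphaDet 2 α ^ l ∈ gridSub l l := by
  rw [alphaDet_two_pow, gridSub_eq_span]
  refine Submodule.sum_mem _ fun j hj => Submodule.smul_mem _ _ (Submodule.subset_span ?_)
  rw [Finset.mem_range] at hj
  exact ⟨⟨j, hj⟩, rfl⟩

theorem hahnFunctional_alphaDet (l s : ℕ) (hs : s ≤ l) (α : ℂ) :
    hahnFunctional l s (alphaDet 2 α ^ l) = (1 + α) ^ (l - s) * G l s α := by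
  rw [alphaDet_two_pow, map_sum, ← sum_choose_mul_pow l s hs]
  refine Finset.sum_congr rfl fun j hj => ?_
  rw [Finset.mem_range] at hj
  rw [map_smul, hahnFunctional_apply (by omega), smul_eq_mul]
  ring

/-- The irreducible submodule of highest weight `(2l - s, s)`. -/
def irredSub (l s : ℕ) : Submodule ℂ (Poly 2) :=
  lowerSpan (detX ^ s * topX ^ (l - s))

theorem zeroWeightVector_mem_irredSub (l s : ℕ) : zeroWeightVector l s ∈ irredSub l s :=
  Submodule.subset_span ⟨l - s, rfl⟩

theorem isIrred_irredSub {l s : ℕ} (hs : s ≤ l) :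
    IsIrredOfHighestWeight (irredSub l s) ![2 * (l : ℂ) - s, (s : ℂ)] := by
  have h := (isPrimitive s (l - s)).isIrredOfHighestWeight
  have e : (s : ℂ) + 2 * ((l - s : ℕ) : ℂ) = 2 * l - s := by
    push_cast [hs]
    ring
  rwa [e] at h

theorem iSupIndep_irredSub (l : ℕ) : iSupIndep fun s : Fin (l + 1) => irredSub l s := by
  have h := (Module.End.eigenspaces_iSupIndep casimir).comp
    (f := fun s : Fin (l + 1) => ((l : ℂ) - (s : ℕ)) * (l - (s : ℕ) + 1))
    (fun s t h => Fin.ext (casimir_eigenvalue_injOn (by omega) (by omega) h))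
  refine h.mono fun s => ?_
  have h1 := (isPrimitive s (l - s)).lowerSpan_le_eigenspace
  have e : ((2 * (l - (s : ℕ)) : ℕ) : ℂ) / 2 * (((2 * (l - (s : ℕ)) : ℕ) : ℂ) / 2 + 1) =
      ((l : ℂ) - (s : ℕ)) * (l - (s : ℕ) + 1) := by
    push_cast [show (s : ℕ) ≤ l by omega]
    ring
  rwa [e] at h1

/-- A stable subspace is stable under polynomials in the Casimir operator; the one vanishing at all
the other eigenvalues isolates the `s`-th component. -/
theorem zeroWeightVector_mem_of_sum_mem {l : ℕ} {N : Submodule ℂ (Poly 2)} (hN : GlStable N)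
    (a : Fin (l + 1) → ℂ) (h : ∑ t, a t • zeroWeightVector l t ∈ N) (s : Fin (l + 1))
    (hs : a s ≠ 0) : zeroWeightVector l s ∈ N := by
  have hr : raise ∈ stabilizer N := hN _
  have hl : lower ∈ stabilizer N := hN _
  have hw : ∀ i, wtOp i ∈ stabilizer N := fun i => hN _
  have hd := Subalgebra.smul_mem _ (Subalgebra.sub_mem _ (hw 0) (hw 1)) (2 : ℂ)⁻¹
  have hc : casimir ∈ stabilizer N := Subalgebra.add_mem _ (Subalgebra.mul_mem _ hl hr)
    (Subalgebra.mul_mem _ hd (Subalgebra.add_mem _ hd (Subalgebra.one_mem _)))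
  set ev : Fin (l + 1) → ℂ := fun s => ((l : ℂ) - (s : ℕ)) * (l - (s : ℕ) + 1) with hev
  set q : Polynomial ℂ := ∏ t ∈ Finset.univ.erase s, (Polynomial.X - Polynomial.C (ev t)) with hq
  have hqc : Polynomial.aeval casimir q ∈ stabilizer N :=
    Algebra.adjoin_le (Set.singleton_subset_iff.2 hc)
      (Polynomial.aeval_mem_adjoin_singleton ℂ casimir (p := q))
  have key : ∀ t : Fin (l + 1), Polynomial.aeval casimir q (zeroWeightVector l t) =
      q.eval (ev t) • zeroWeightVector l t := fun t =>
    Module.End.aeval_apply_of_hasEigenvector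
      ⟨Module.End.mem_eigenspace_iff.2 (casimir_zeroWeightVector (by omega)),
        zeroWeightVector_ne_zero _ _⟩
  have h1 := hqc _ h
  rw [map_sum, Finset.sum_eq_single s] at h1
  · rw [map_smul, key, smul_smul] at h1
    refine (N.smul_mem_iff (mul_ne_zero hs ?_)).1 h1
    rw [hq, Polynomial.eval_prod, Finset.prod_ne_zero_iff]
    intro t ht
    rw [Polynomial.eval_sub, Polynomial.eval_X, Polynomial.eval_C, sub_ne_zero]
    intro h2
    exact Finset.ne_of_mem_erase ht
      (Fin.ext (casimir_eigenvalue_injOn (by omega) (by omega) h2).symm)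
  · intro t _ ht
    rw [map_smul, key, hq, Polynomial.eval_prod,
      Finset.prod_eq_zero (Finset.mem_erase.2 ⟨ht, Finset.mem_univ t⟩) (by simp), zero_smul,
      smul_zero]
  · simp

theorem iSup_irredSub (l : ℕ) (α : ℂ) :
    ⨆ s : {s : Fin (l + 1) // (1 + α) ^ (l - (s : ℕ)) * G l s α ≠ 0}, irredSub l (s : Fin (l + 1)) =
      cyclicModule 2 l α := by
  have hmem := alphaDet_two_pow_mem l α
  rw [← span_zeroWeightVector] at hmem
  obtain ⟨a, ha⟩ := (Submodule.mem_span_range_iff_exists_fun ℂ).1 hmem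
  have hF : ∀ s : Fin (l + 1), (1 + α) ^ (l - (s : ℕ)) * G l s α ≠ 0 ↔ a s ≠ 0 := by
    intro s
    rw [← hahnFunctional_alphaDet l s (by omega), ← ha, hahnFunctional_sum]
    simp [hahnFunctional_zeroWeightVector_ne_zero s]
  apply le_antisymm
  · refine iSup_le fun s => ?_
    have hirr := isIrred_irredSub (l := l) (s := (s : Fin (l + 1))) (by omega)
    have hw : zeroWeightVector l (s : Fin (l + 1)) ∈ cyclicModule 2 l α := by
      refine zeroWeightVector_mem_of_sum_mem (glStable_cyclicModule 2 l α) a ?_ s ((hF s).1 s.2)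
      rw [ha]
      exact alphaDet_pow_mem_cyclicModule 2 l α
    -- The intersection contains a nonzero zero weight vector, so by irreducibility it is the whole
    -- of `irredSub l s`.
    rcases hirr.irred (irredSub l (s : Fin (l + 1)) ⊓ cyclicModule 2 l α) inf_le_left
      (hirr.stable.inf (glStable_cyclicModule 2 l α)) with h | h
    · exfalso
      apply zeroWeightVector_ne_zero l (s : Fin (l + 1))
      rw [← Submodule.mem_bot ℂ, ← h]
      exact ⟨zeroWeightVector_mem_irredSub _ _, hw⟩
    · exact inf_eq_left.1 h
  · refine cyclicModule_le (GlStable.iSup fun s => (isIrred_irredSub (by omega)).stable) ?_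
    rw [← ha]
    refine Submodule.sum_mem _ fun s _ => ?_
    by_cases hs : a s = 0
    · rw [hs, zero_smul]
      exact Submodule.zero_mem _
    · exact Submodule.smul_mem _ _ (Submodule.mem_iSup_of_mem ⟨s, (hF s).2 hs⟩
        (zeroWeightVector_mem_irredSub l s))

theorem exists_irreducible_decomposition (l : ℕ) (α : ℂ) :
    ∃ N : {s : Fin (l + 1) // (1 + α) ^ (l - (s : ℕ)) * G l s α ≠ 0} → Submodule ℂ (Poly 2),
      (∀ s, IsIrredOfHighestWeight (N s)
        ![2 * (l : ℂ) - ((s : Fin (l + 1)) : ℕ), (((s : Fin (l + 1)) : ℕ) : ℂ)]) ∧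
      iSupIndep N ∧ ⨆ s, N s = cyclicModule 2 l α :=
  ⟨fun s => irredSub l (s : Fin (l + 1)), fun _ => isIrred_irredSub (by omega),
    (iSupIndep_irredSub l).comp Subtype.val_injective, iSup_irredSub l α⟩

end Decomposition

/-! ### Averages over a subgroup -/

section Average

variable {G V : Type*} [Group G] [AddCommGroup V] [Module ℂ V] (ρ : Representation ℂ G V)
  (K : Subgroup G) [Fintype K]

/-- The average of `ρ` over the subgroup `K`. -/
def subgroupAverage : V →ₗ[ℂ] V :=
  (Fintype.card K : ℂ)⁻¹ • ∑ k : K, ρ k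

theorem subgroupAverage_apply (v : V) :
    subgroupAverage ρ K v = (Fintype.card K : ℂ)⁻¹ • ∑ k : K, ρ k v := by
  simp [subgroupAverage]

theorem card_subgroup_ne_zero : (Fintype.card K : ℂ) ≠ 0 := by
  exact_mod_cast Fintype.card_ne_zero

variable {K}

theorem subgroupAverage_of_invariant {v : V} (hv : ∀ k ∈ K, ρ k v = v) :
    subgroupAverage ρ K v = v := by
  rw [subgroupAverage_apply, Finset.sum_congr rfl fun (k : K) _ => hv k k.2]
  simp only [Finset.sum_const, Finset.card_univ]
  rw [← Nat.cast_smul_eq_nsmul ℂ, smul_smul, inv_mul_cancel₀ (card_subgroup_ne_zero K), one_smul]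

theorem apply_subgroupAverage {k : G} (hk : k ∈ K) (v : V) :
    ρ k (subgroupAverage ρ K v) = subgroupAverage ρ K v := by
  rw [subgroupAverage_apply, map_smul, map_sum]
  congr 1
  refine Fintype.sum_equiv (Equiv.mulLeft (⟨k, hk⟩ : K)) _ _ fun x => ?_
  simp [map_mul]

theorem subgroupAverage_apply_mem {k : G} (hk : k ∈ K) (v : V) :
    subgroupAverage ρ K (ρ k v) = subgroupAverage ρ K v := by
  rw [subgroupAverage_apply, subgroupAverage_apply]
  congr 1
  refine Fintype.sum_equiv (Equiv.mulRight (⟨k, hk⟩ : K)) _ _ fun x => ?_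
  simp [map_mul]

variable {ρ} {ev : V →ₗ[ℂ] ℂ} {v₀ : V}

theorem mem_invariants_iff_eq_smul (h : ∀ v, subgroupAverage ρ K v = ev v • v₀) {v : V} :
    v ∈ Representation.invariants (ρ.comp K.subtype) ↔ v = ev v • v₀ := by
  rw [Representation.mem_invariants]
  constructor
  · intro hv
    rw [← h v, subgroupAverage_of_invariant ρ fun k hk => hv ⟨k, hk⟩]
  · intro hv k
    rw [hv, ← h]
    exact apply_subgroupAverage ρ k.2 v

theorem finrank_invariants_eq_one (h : ∀ v, subgroupAverage ρ K v = ev v • v₀) (h₀ : ev v₀ = 1) :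
    Module.finrank ℂ (Representation.invariants (ρ.comp K.subtype)) = 1 := by
  have hs : Representation.invariants (ρ.comp K.subtype) = Submodule.span ℂ {v₀} := by
    ext v
    rw [mem_invariants_iff_eq_smul h, Submodule.mem_span_singleton]
    constructor
    · intro hv
      exact ⟨_, hv.symm⟩
    · rintro ⟨c, rfl⟩
      simp [h₀]
  rw [hs]
  refine finrank_span_singleton fun h' => ?_
  rw [h', map_zero] at h₀
  exact zero_ne_one h₀

/-- Average composed with `ρ g` is the rank-one operator `v ↦ ev(ρ g v) v₀`, whose trace is `ev(ρ g
v₀)`. -/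
theorem average_trace [Module.Finite ℂ V] (h : ∀ v, subgroupAverage ρ K v = ev v • v₀) (g : G) :
    (Fintype.card K : ℂ)⁻¹ * ∑ k : K, LinearMap.trace ℂ V (ρ ((k : G) * g)) = ev (ρ g v₀) := by
  have h1 : subgroupAverage ρ K ∘ₗ ρ g = (ev ∘ₗ ρ g).smulRight v₀ := by
    ext v
    simp [h]
  rw [← LinearMap.comp_apply, ← LinearMap.trace_smulRight, ← h1, ← map_sum, ← smul_eq_mul,
    ← map_smul]
  congr 1
  ext v
  simp [subgroupAverage_apply]

end Average

/-! ### Permutations of a finite set -/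

section Perm

open Finset

theorem exists_perm_comp_eq {ι X : Type*} [Finite X] {f g : ι → X} (hf : Function.Injective f)
    (hg : Function.Injective g) : ∃ σ : Equiv.Perm X, ∀ i, σ (f i) = g i := by
  classical
  let e : {x // x ∈ Set.range f} ≃ {x // x ∈ Set.range g} :=
    (Equiv.ofInjective f hf).symm.trans (Equiv.ofInjective g hg)
  refine ⟨e.extendSubtype, fun i => ?_⟩
  rw [Equiv.extendSubtype_apply_of_mem e (f i) ⟨i, rfl⟩]
  have : (⟨f i, ⟨i, rfl⟩⟩ : {x // x ∈ Set.range f}) = Equiv.ofInjective f hf i := rfl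
  rw [this, Equiv.trans_apply, Equiv.symm_apply_apply]
  rfl

variable {X : Type*} [Fintype X] [DecidableEq X]

theorem card_perm_map_subset_eq {J J' : Finset X} (h : J.card = J'.card) (S : Finset X) :
    #{σ : Equiv.Perm X | J.map σ.toEmbedding ⊆ S} =
      #{σ : Equiv.Perm X | J'.map σ.toEmbedding ⊆ S} := by
  obtain ⟨π, hπ⟩ := exists_perm_comp_eq (f := fun x : J => (x : X))
    (g := fun x : J => (Finset.equivOfCardEq h x : X)) Subtype.val_injective
    (Subtype.val_injective.comp (Finset.equivOfCardEq h).injective)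
  have hJ : J.map π.toEmbedding = J' := by
    refine Finset.eq_of_subset_of_card_le ?_ (by rw [card_map, h])
    intro y hy
    obtain ⟨x, hx, rfl⟩ := Finset.mem_map.1 hy
    have := hπ ⟨x, hx⟩
    simp only at this
    rw [Equiv.coe_toEmbedding, this]
    exact Subtype.property _
  refine Finset.card_equiv (Equiv.mulRight π⁻¹) fun σ => ?_
  simp only [mem_filter, mem_univ, true_and, Equiv.coe_mulRight]
  rw [← hJ, Finset.map_map]
  have : π.toEmbedding.trans (σ * π⁻¹).toEmbedding = σ.toEmbedding := by
    ext x
    simp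
  rw [this]

/-- Double counting of pairs `(J', σ)` with `|J'| = |J|` and `σ(J') ⊆ S`: the count over `σ` does
not depend on `J'`, and for fixed `σ` the `J'` are the subsets of `σ⁻¹(S)` of that size. -/
theorem choose_mul_card_perm_map_subset (J S : Finset X) :
    (Fintype.card X).choose J.card * #{σ : Equiv.Perm X | J.map σ.toEmbedding ⊆ S} =
      (Fintype.card X).factorial * S.card.choose J.card := by
  have h1 : ∑ J' ∈ powersetCard J.card univ, #{σ : Equiv.Perm X | J'.map σ.toEmbedding ⊆ S} =
      (Fintype.card X).choose J.card * #{σ : Equiv.Perm X | J.map σ.toEmbedding ⊆ S} := by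
    rw [Finset.sum_congr rfl fun J' hJ' =>
      card_perm_map_subset_eq (mem_powersetCard.1 hJ').2 S]
    simp [card_powersetCard]
  have h2 := Finset.sum_card_bipartiteAbove_eq_sum_card_bipartiteBelow
    (s := powersetCard J.card (univ : Finset X)) (t := (univ : Finset (Equiv.Perm X)))
    (fun J' σ => J'.map σ.toEmbedding ⊆ S)
  rw [← h1]
  refine h2.trans ?_
  have h3 : ∀ σ : Equiv.Perm X, #(bipartiteBelow (fun J' σ => J'.map σ.toEmbedding ⊆ S)
      (powersetCard J.card (univ : Finset X)) σ) = S.card.choose J.card := by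
    intro σ
    rw [← card_map σ.symm.toEmbedding (s := S), ← card_powersetCard]
    congr 1
    ext J'
    simp only [mem_bipartiteBelow, mem_powersetCard, subset_univ, true_and]
    rw [and_comm]
    refine and_congr_left fun _ => ?_
    simp only [Finset.subset_iff, mem_map_equiv, Equiv.symm_symm]
    constructor
    · intro h x hx
      exact h (by simpa using hx)
    · intro h x hx
      simpa using h hx
  rw [Finset.sum_congr rfl fun σ _ => h3 σ]
  simp [Fintype.card_perm]

theorem sum_perm_prod_boole (J S : Finset X) :
    ∑ σ : Equiv.Perm X, ∏ i ∈ J, (if σ i ∈ S then (1 : ℂ) else 0) =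
      (Fintype.card X).factorial * ((S.card.choose J.card : ℂ) /
        ((Fintype.card X).choose J.card : ℂ)) := by
  have h := choose_mul_card_perm_map_subset J S
  have h0 : ((Fintype.card X).choose J.card : ℂ) ≠ 0 := by
    exact_mod_cast (Nat.choose_pos (card_le_univ J)).ne'
  rw [← mul_div_assoc, eq_div_iff h0, mul_comm]
  have h1 : ∑ σ : Equiv.Perm X, ∏ i ∈ J, (if σ i ∈ S then (1 : ℂ) else 0) =
      (#{σ : Equiv.Perm X | J.map σ.toEmbedding ⊆ S} : ℂ) := by
    simp_rw [prod_boole, ← Finset.sum_boole]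
    refine Finset.sum_congr rfl fun σ _ => ?_
    congr 1
    simp only [Finset.subset_iff, Finset.mem_map, Equiv.coe_toEmbedding, forall_exists_index,
      and_imp, forall_apply_eq_imp_iff₂]
  rw [h1]
  exact_mod_cast h

end Perm

/-! ### Specht polynomials of two-row tableaux -/

section TwoRow

open MvPolynomial

theorem mem_twoRow {l p : ℕ} {hp : p ≤ l} {c : ℕ × ℕ} :
    c ∈ twoRow l p hp ↔ (c.1 = 0 ∧ c.2 < 2 * l - p) ∨ (c.1 = 1 ∧ c.2 < p) := by
  obtain ⟨i, j⟩ := c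
  rw [twoRow, YoungDiagram.mem_ofRowLens]
  rcases i with _ | _ | i
  · simp
  · simp
  · simp

theorem card_twoRow {l p : ℕ} (hp : p ≤ l) : (twoRow l p hp).cells.card = 2 * l := by
  have h : (twoRow l p hp).cells =
      ({0} ×ˢ Finset.range (2 * l - p)) ∪ ({1} ×ˢ Finset.range p) := by
    ext c
    rw [YoungDiagram.mem_cells, mem_twoRow]
    simp only [Finset.mem_union, Finset.mem_product, Finset.mem_singleton, Finset.mem_range]
  rw [h, Finset.card_union_of_disjoint]
  · simp
    omega
  · rw [Finset.disjoint_left]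
    intro c hc hc'
    simp only [Finset.mem_product, Finset.mem_singleton] at hc hc'
    omega

/-- The product of `x_{f(0, j)} - x_{f(1, j)}` over `j < p`. -/
def columnPoly {X : Type*} {p : ℕ} (f : Fin 2 × Fin p → X) : MvPolynomial X ℂ :=
  ∏ j, (MvPolynomial.X (f (0, j)) - MvPolynomial.X (f (1, j)))

/-- The box of `(2l - p, p)` in the row `i` and in the column `j < p`. -/
def twoRowCell {l p : ℕ} (hp : p ≤ l) (x : Fin 2 × Fin p) : (twoRow l p hp).cells :=
  ⟨((x.1 : ℕ), (x.2 : ℕ)), by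
    rw [YoungDiagram.mem_cells, mem_twoRow]
    have := x.1.2
    have := x.2.2
    simp only
    omega⟩

theorem twoRowCell_injective {l p : ℕ} (hp : p ≤ l) : Function.Injective (twoRowCell hp) := by
  rintro ⟨i, j⟩ ⟨i', j'⟩ h
  have h' := congrArg Subtype.val h
  simp only [twoRowCell, Prod.mk.injEq] at h'
  exact Prod.ext (Fin.ext h'.1) (Fin.ext h'.2)

/-- Only the first `p` columns have two boxes, and each of them contributes one factor. -/
theorem spechtPolynomial_twoRow {X : Type*} [Fintype X] {l p : ℕ} (hp : p ≤ l)
    (T : (twoRow l p hp).cells ≃ X) :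
    spechtPolynomial (twoRow l p hp) T = columnPoly fun x => T (twoRowCell hp x) := by
  rw [spechtPolynomial, columnPoly]
  symm
  refine Finset.prod_bij (fun j _ => (twoRowCell hp (0, j), twoRowCell hp (1, j))) ?_ ?_ ?_ ?_
  · intro j _
    simp [twoRowCell]
  · intro j _ j' _ h
    have := twoRowCell_injective hp (congrArg Prod.fst h)
    simpa using this
  · rintro ⟨⟨⟨i, j⟩, hc⟩, ⟨⟨i', j'⟩, hc'⟩⟩ h
    simp only [Finset.mem_filter, Finset.mem_univ, true_and] at h
    rw [YoungDiagram.mem_cells, mem_twoRow] at hc hc'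
    simp only at hc hc'
    obtain ⟨rfl, h2⟩ := h
    obtain rfl : i = 0 := by omega
    obtain rfl : i' = 1 := by omega
    refine ⟨⟨j, by omega⟩, Finset.mem_univ _, ?_⟩
    simp [twoRowCell]
  · intro j _
    rfl

variable {l p : ℕ}

theorem nonempty_twoRow_equiv (hp : p ≤ l) :
    Nonempty ((twoRow l p hp).cells ≃ Fin 2 × Fin l) := by
  rw [← Fintype.card_eq, Fintype.card_coe, card_twoRow]
  simp

theorem columnPoly_mem (hp : p ≤ l) {f : Fin 2 × Fin p → Fin 2 × Fin l}
    (hf : Function.Injective f) :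
    columnPoly f ∈ (spechtSub (Fin 2 × Fin l) (twoRow l p hp)).toSubmodule := by
  obtain ⟨T⟩ := nonempty_twoRow_equiv hp
  obtain ⟨σ, hσ⟩ := exists_perm_comp_eq (T.injective.comp (twoRowCell_injective hp)) hf
  refine Submodule.subset_span ⟨T.trans σ, ?_⟩
  refine (spechtPolynomial_twoRow hp _).trans (congrArg columnPoly (funext fun x => ?_))
  exact hσ x

/-- The Specht polynomial of an injective filling, as an element of the Specht module. -/
def columnVec (hp : p ≤ l) (f : Fin 2 × Fin p → Fin 2 × Fin l) (hf : Function.Injective f) :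
    SpechtModule (Fin 2 × Fin l) (twoRow l p hp) :=
  ⟨columnPoly f, columnPoly_mem hp hf⟩

theorem spechtRep_columnVec (hp : p ≤ l) (f : Fin 2 × Fin p → Fin 2 × Fin l)
    (hf : Function.Injective f) (g : Equiv.Perm (Fin 2 × Fin l)) :
    spechtRep (Fin 2 × Fin l) (twoRow l p hp) g (columnVec hp f hf) =
      columnVec hp (g ∘ f) (g.injective.comp hf) := by
  apply Subtype.ext
  change MvPolynomial.rename g (columnPoly f) = columnPoly (g ∘ f)
  simp [columnPoly, map_prod]

theorem spechtModule_induction (hp : p ≤ l)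
    {P : SpechtModule (Fin 2 × Fin l) (twoRow l p hp) → Prop}
    (mem : ∀ f hf, P (columnVec hp f hf)) (zero : P 0) (add : ∀ v w, P v → P w → P (v + w))
    (smul : ∀ (c : ℂ) v, P v → P (c • v)) (v) : P v := by
  obtain ⟨v, hv⟩ := v
  change v ∈ Submodule.span ℂ _ at hv
  induction hv using Submodule.span_induction with
  | mem x hx =>
    obtain ⟨T, rfl⟩ := hx
    have h := mem (fun x => T (twoRowCell hp x)) (T.injective.comp (twoRowCell_injective hp))
    simp only [columnVec, ← spechtPolynomial_twoRow] at h
    exact h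
  | zero => exact zero
  | add x y hx hy ihx ihy => exact add ⟨x, hx⟩ ⟨y, hy⟩ ihx ihy
  | smul c x hx ih => exact smul c ⟨x, hx⟩ ih

instance finite_spechtModule (μ : YoungDiagram) :
    Module.Finite ℂ (SpechtModule (Fin 2 × Fin l) μ) :=
  Module.Finite.span_of_finite ℂ (Set.finite_range _)

/-- The indicator function of the first row. -/
def firstRow (l : ℕ) (x : Fin 2 × Fin l) : ℂ := if x.1 = 0 then 1 else 0

/-- Evaluation at the indicator function of the first row. -/
def rowEval (hp : p ≤ l) : SpechtModule (Fin 2 × Fin l) (twoRow l p hp) →ₗ[ℂ] ℂ :=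
  (MvPolynomial.aeval (firstRow l)).toLinearMap ∘ₗ Submodule.subtype _

theorem rowEval_columnVec (hp : p ≤ l) (f : Fin 2 × Fin p → Fin 2 × Fin l)
    (hf : Function.Injective f) :
    rowEval hp (columnVec hp f hf) = ∏ j, (firstRow l (f (0, j)) - firstRow l (f (1, j))) := by
  simp [rowEval, columnVec, columnPoly]

theorem mem_rowGroup {n : ℕ} {g : Equiv.Perm (Fin n × Fin l)} :
    g ∈ rowGroup n l ↔ ∀ x, (g x).1 = x.1 := Iff.rfl

theorem mem_colGroup {n : ℕ} {g : Equiv.Perm (Fin n × Fin l)} :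
    g ∈ colGroup n l ↔ ∀ x, (g x).2 = x.2 := Iff.rfl

theorem rowEval_apply (hp : p ≤ l) {k : Equiv.Perm (Fin 2 × Fin l)} (hk : k ∈ rowGroup 2 l)
    (v : SpechtModule (Fin 2 × Fin l) (twoRow l p hp)) :
    rowEval hp (spechtRep (Fin 2 × Fin l) (twoRow l p hp) k v) = rowEval hp v := by
  induction v using spechtModule_induction with
  | mem f hf =>
    rw [spechtRep_columnVec, rowEval_columnVec, rowEval_columnVec]
    simp [firstRow, mem_rowGroup.1 hk]
  | zero => simp
  | add v w hv hw => rw [map_add, map_add, hv, hw, map_add]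
  | smul c v hv => rw [map_smul, map_smul, hv, map_smul]

/-- The standard embedding of the first `p` columns. -/
def stdEmb (hp : p ≤ l) (x : Fin 2 × Fin p) : Fin 2 × Fin l := (x.1, Fin.castLE hp x.2)

theorem stdEmb_injective (hp : p ≤ l) : Function.Injective (stdEmb hp) := by
  rintro ⟨i, j⟩ ⟨i', j'⟩ h
  simpa [stdEmb] using h

/-- The generator of the invariants of the row group in the Specht module of `(2l - p, p)`. -/
def sphericalVec (hp : p ≤ l) : SpechtModule (Fin 2 × Fin l) (twoRow l p hp) :=
  subgroupAverage (spechtRep (Fin 2 × Fin l) (twoRow l p hp)) (rowGroup 2 l)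
    (columnVec hp (stdEmb hp) (stdEmb_injective hp))

theorem rowEval_average (hp : p ≤ l) (v : SpechtModule (Fin 2 × Fin l) (twoRow l p hp)) :
    rowEval hp (subgroupAverage (spechtRep (Fin 2 × Fin l) (twoRow l p hp)) (rowGroup 2 l) v) =
      rowEval hp v := by
  rw [subgroupAverage_apply, map_smul, map_sum,
    Finset.sum_congr rfl fun k _ => rowEval_apply hp (Subtype.property k) v]
  simp only [Finset.sum_const, Finset.card_univ]
  rw [nsmul_eq_mul, smul_eq_mul, ← mul_assoc, inv_mul_cancel₀ (card_subgroup_ne_zero _), one_mul]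

theorem rowEval_sphericalVec (hp : p ≤ l) : rowEval hp (sphericalVec hp) = 1 := by
  rw [sphericalVec, rowEval_average, rowEval_columnVec]
  simp [firstRow, stdEmb]

/-- The element of the row group that acts by `σ` and `τ` on the rows. -/
def rowPerm (x : Equiv.Perm (Fin l) × Equiv.Perm (Fin l)) : rowGroup 2 l :=
  ⟨Equiv.prodCongrRight ![x.1, x.2], fun _ => rfl⟩

theorem rowPerm_bijective :
    Function.Bijective (rowPerm : Equiv.Perm (Fin l) × Equiv.Perm (Fin l) → rowGroup 2 l) := by
  constructor
  · rintro ⟨σ, τ⟩ ⟨σ', τ'⟩ h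
    have h' : ∀ y, (rowPerm (σ, τ) : Equiv.Perm (Fin 2 × Fin l)) y =
      (rowPerm (σ', τ') : Equiv.Perm (Fin 2 × Fin l)) y := fun y => by rw [h]
    refine Prod.ext (Equiv.ext fun j => ?_) (Equiv.ext fun j => ?_)
    · exact congrArg Prod.snd (h' (0, j))
    · exact congrArg Prod.snd (h' (1, j))
  · rintro ⟨k, hk⟩
    rw [mem_rowGroup] at hk
    have hinj : ∀ i, Function.Injective fun j => (k (i, j)).2 := by
      intro i j j' h
      have : k (i, j) = k (i, j') := Prod.ext (by rw [hk, hk]) h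
      simpa using k.injective this
    let σ : Fin 2 → Equiv.Perm (Fin l) := fun i =>
      Equiv.ofBijective _ (Finite.injective_iff_bijective.1 (hinj i))
    refine ⟨(σ 0, σ 1), Subtype.ext (Equiv.ext ?_)⟩
    rintro ⟨i, j⟩
    refine Prod.ext ?_ ?_
    · rw [hk]
      rfl
    · fin_cases i <;> rfl

theorem exists_rowGroup_comp_stdEmb (hp : p ≤ l) {f : Fin 2 × Fin p → Fin 2 × Fin l}
    (hf : Function.Injective f) (hrow : ∀ x, (f x).1 = x.1) :
    ∃ k ∈ rowGroup 2 l, f = k ∘ stdEmb hp := by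
  have h : ∀ i, ∃ σ : Equiv.Perm (Fin l), ∀ j, σ (Fin.castLE hp j) = (f (i, j)).2 := by
    intro i
    refine exists_perm_comp_eq (Fin.castLE_injective hp) fun j j' h => ?_
    have : f (i, j) = f (i, j') := Prod.ext (by rw [hrow, hrow]) h
    simpa using hf this
  choose σ hσ using h
  refine ⟨rowPerm (σ 0, σ 1), Subtype.property _, funext ?_⟩
  rintro ⟨i, j⟩
  refine Prod.ext (hrow _) ?_
  fin_cases i
  · exact (hσ 0 j).symm
  · exact (hσ 1 j).symm

/-- A pair within one row admits a transposition in the row group that negates the vector, so its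
average is zero, as is its evaluation. Otherwise every pair meets both rows; orienting the pairs
costs a sign equal to the evaluation, and the oriented filling is a row translate of the standard
one. -/
theorem average_columnVec (hp : p ≤ l) (f : Fin 2 × Fin p → Fin 2 × Fin l)
    (hf : Function.Injective f) :
    subgroupAverage (spechtRep (Fin 2 × Fin l) (twoRow l p hp)) (rowGroup 2 l)
      (columnVec hp f hf) = rowEval hp (columnVec hp f hf) • sphericalVec hp := by
  by_cases h : ∃ j, (f (0, j)).1 = (f (1, j)).1
  · obtain ⟨j, hj⟩ := h
    have h0 : rowEval hp (columnVec hp f hf) = 0 := by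
      rw [rowEval_columnVec]
      exact Finset.prod_eq_zero (Finset.mem_univ j) (by simp [firstRow, hj])
    have hτ : Equiv.swap (f (0, j)) (f (1, j)) ∈ rowGroup 2 l := by
      rw [mem_rowGroup]
      intro x
      rw [Equiv.swap_apply_def]
      split_ifs with h1 h2
      · rw [h1, hj]
      · rw [h2, hj]
      · rfl
    have hneg : columnVec hp _ ((Equiv.swap (f (0, j)) (f (1, j))).injective.comp hf) =
        -columnVec hp f hf := by
      apply Subtype.ext
      change columnPoly _ = -columnPoly f
      rw [columnPoly, columnPoly, ← Finset.mul_prod_erase _ _ (Finset.mem_univ j),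
        ← Finset.mul_prod_erase _ _ (Finset.mem_univ j), ← neg_mul]
      congr 1
      · simp
      · refine Finset.prod_congr rfl fun i hi => ?_
        have hij : i ≠ j := Finset.ne_of_mem_erase hi
        have hne : ∀ a b : Fin 2, f (a, i) ≠ f (b, j) := fun a b h => hij (Prod.ext_iff.1 (hf h)).2
        simp only [Function.comp_apply]
        rw [Equiv.swap_apply_of_ne_of_ne (hne _ _) (hne _ _),
          Equiv.swap_apply_of_ne_of_ne (hne _ _) (hne _ _)]
    have h1 := subgroupAverage_apply_mem (spechtRep (Fin 2 × Fin l) (twoRow l p hp)) hτ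
      (columnVec hp f hf)
    rw [spechtRep_columnVec, hneg, map_neg] at h1
    rw [h0, zero_smul]
    have h2 : (2 : ℂ) • subgroupAverage (spechtRep (Fin 2 × Fin l) (twoRow l p hp))
        (rowGroup 2 l) (columnVec hp f hf) = 0 := by
      rw [two_smul]
      nth_rewrite 1 [← h1]
      exact neg_add_cancel _
    exact (smul_eq_zero.1 h2).resolve_left two_ne_zero
  · push Not at h
    have hswap : ∀ j, (f (0, j)).1 ≠ 0 → (f (0, j)).1 = 1 ∧ (f (1, j)).1 = 0 := by
      intro j hj
      have := h j
      omega
    -- Exchanges the two entries of each column whose top entry lies in the second row.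
    set f' : Fin 2 × Fin p → Fin 2 × Fin l := fun x =>
      if (f (0, x.2)).1 = 0 then f x else f (x.1.rev, x.2) with hf'
    have hrow : ∀ x, (f' x).1 = x.1 := by
      rintro ⟨i, j⟩
      simp only [hf']
      split_ifs with h1
      · have := h j
        fin_cases i
        · exact h1
        · simp only [Fin.mk_one] at this ⊢
          omega
      · have h2 := hswap j h1
        fin_cases i
        · exact h2.2
        · exact h2.1
    have hinj : Function.Injective f' := by
      rintro ⟨i, j⟩ ⟨i', j'⟩ hx
      have hi : i = i' := by
        have := congrArg Prod.fst hx
        rwa [hrow, hrow] at this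
      subst hi
      have : j = j' := by
        simp only [hf'] at hx
        split_ifs at hx <;> exact (Prod.ext_iff.1 (hf hx)).2
      rw [this]
    obtain ⟨k, hk, hk'⟩ := exists_rowGroup_comp_stdEmb hp hinj hrow
    have hcol : columnVec hp f hf = rowEval hp (columnVec hp f hf) • columnVec hp f' hinj := by
      apply Subtype.ext
      change columnPoly f = rowEval hp (columnVec hp f hf) • columnPoly f'
      rw [rowEval_columnVec, columnPoly, columnPoly, MvPolynomial.smul_eq_C_mul, map_prod,
        ← Finset.prod_mul_distrib]
      refine Finset.prod_congr rfl fun j _ => ?_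
      by_cases h1 : (f (0, j)).1 = 0
      · have h2 : (f (1, j)).1 ≠ 0 := fun h2 => h j (h1.trans h2.symm)
        simp [hf', h1, h2, firstRow]
      · simp [hf', (hswap j h1), firstRow]
    have hvec : columnVec hp f' hinj = spechtRep (Fin 2 × Fin l) (twoRow l p hp) k
        (columnVec hp (stdEmb hp) (stdEmb_injective hp)) := by
      rw [spechtRep_columnVec]
      exact Subtype.ext (congrArg columnPoly hk')
    have havg := congrArg (subgroupAverage (spechtRep (Fin 2 × Fin l) (twoRow l p hp))
      (rowGroup 2 l)) hcol
    rwa [map_smul, hvec, subgroupAverage_apply_mem _ hk] at havg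

theorem average_eq (hp : p ≤ l) (v : SpechtModule (Fin 2 × Fin l) (twoRow l p hp)) :
    subgroupAverage (spechtRep (Fin 2 × Fin l) (twoRow l p hp)) (rowGroup 2 l) v =
      rowEval hp v • sphericalVec hp := by
  induction v using spechtModule_induction with
  | mem f hf => exact average_columnVec hp f hf
  | zero => simp
  | add v w hv hw => rw [map_add, hv, hw, map_add, add_smul]
  | smul c v hv => rw [map_smul, hv, map_smul, smul_smul, smul_eq_mul]

theorem finrank_rowInvariants (hp : p ≤ l) :
    Module.finrank ℂ (rowInvariants (spechtRep (Fin 2 × Fin l) (twoRow l p hp))) = 1 :=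
  finrank_invariants_eq_one (average_eq hp) (rowEval_sphericalVec hp)

theorem zonal_eq (hp : p ≤ l) (g : Equiv.Perm (Fin 2 × Fin l)) :
    zonal 2 l (twoRow l p hp) g =
      rowEval hp (spechtRep (Fin 2 × Fin l) (twoRow l p hp) g (sphericalVec hp)) :=
  average_trace (average_eq hp) g

end TwoRow

section ZonalValues

variable {l p : ℕ}

/-! ### Values of the zonal spherical functions on the column group -/

/-- The element of the column group that exchanges the boxes of the columns in `A`. -/
def flipPerm (A : Finset (Fin l)) : Equiv.Perm (Fin 2 × Fin l) :=
  Function.Involutive.toPerm (fun x => if x.2 ∈ A then (Fin.rev x.1, x.2) else x)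
    (fun x => by by_cases h : x.2 ∈ A <;> simp [h])

theorem flipPerm_apply (A : Finset (Fin l)) (x : Fin 2 × Fin l) :
    flipPerm A x = if x.2 ∈ A then (Fin.rev x.1, x.2) else x := rfl

theorem flipPerm_inv (A : Finset (Fin l)) : (flipPerm A)⁻¹ = flipPerm A := rfl

theorem gPerm_eq (s : ℕ) :
    gPerm l s = flipPerm (Finset.univ.filter fun j : Fin l => (j : ℕ) < s) := by
  ext x : 1
  simp only [flipPerm_apply, Finset.mem_filter, Finset.mem_univ, true_and]
  rfl

theorem card_filter_lt {s : ℕ} (hs : s ≤ l) :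
    (Finset.univ.filter fun j : Fin l => (j : ℕ) < s).card = s := by
  rw [Fin.card_filter_val_lt]
  omega

theorem card_rowGroup : (Fintype.card (rowGroup 2 l) : ℂ) = (l.factorial : ℂ) * l.factorial := by
  rw [← Fintype.card_of_bijective (rowPerm_bijective (l := l)), Fintype.card_prod,
    Fintype.card_perm, Fintype.card_fin, Nat.cast_mul]

/-- Expand the product over the set `J` of factors where the second term is chosen. The sums over
the two permutations separate and depend on `J` only through its size. -/
theorem sum_perm_prod_sub (hp : p ≤ l) (A B : Finset (Fin l)) :
    ∑ x : Equiv.Perm (Fin l) × Equiv.Perm (Fin l), ∏ j : Fin p,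
      ((if x.1 (Fin.castLE hp j) ∈ B then (1 : ℂ) else 0) -
        (if x.2 (Fin.castLE hp j) ∈ A then (1 : ℂ) else 0)) =
    (l.factorial : ℂ) * l.factorial * ∑ j ∈ Finset.range (p + 1), (p.choose j : ℂ) * ((-1) ^ j *
      ((A.card.choose j : ℂ) / (l.choose j : ℂ)) *
      ((B.card.choose (p - j) : ℂ) / (l.choose (p - j) : ℂ))) := by
  have h1 : ∀ (J : Finset (Fin p)) (S : Finset (Fin l)), ∑ σ : Equiv.Perm (Fin l),
      ∏ j ∈ J, (if σ (Fin.castLE hp j) ∈ S then (1 : ℂ) else 0) =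
      l.factorial * ((S.card.choose J.card : ℂ) / (l.choose J.card : ℂ)) := by
    intro J S
    have := sum_perm_prod_boole (J.map (Fin.castLEEmb hp)) S
    simpa using this
  have h2 : ∀ x : Equiv.Perm (Fin l) × Equiv.Perm (Fin l), ∏ j : Fin p,
      ((if x.1 (Fin.castLE hp j) ∈ B then (1 : ℂ) else 0) -
        (if x.2 (Fin.castLE hp j) ∈ A then (1 : ℂ) else 0)) =
      ∑ J ∈ (Finset.univ : Finset (Fin p)).powerset, (-1) ^ J.card *
        ((∏ j ∈ J, (if x.2 (Fin.castLE hp j) ∈ A then (1 : ℂ) else 0)) *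
        ∏ j ∈ Finset.univ \ J, (if x.1 (Fin.castLE hp j) ∈ B then (1 : ℂ) else 0)) := by
    intro x
    simp_rw [sub_eq_neg_add]
    rw [Finset.prod_add]
    refine Finset.sum_congr rfl fun J _ => ?_
    rw [Finset.prod_neg, mul_assoc]
  rw [Finset.sum_congr rfl fun x _ => h2 x, Finset.sum_comm]
  have h3 : ∀ J ∈ (Finset.univ : Finset (Fin p)).powerset,
      ∑ x : Equiv.Perm (Fin l) × Equiv.Perm (Fin l), (-1 : ℂ) ^ J.card *
        ((∏ j ∈ J, (if x.2 (Fin.castLE hp j) ∈ A then (1 : ℂ) else 0)) *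
        ∏ j ∈ Finset.univ \ J, (if x.1 (Fin.castLE hp j) ∈ B then (1 : ℂ) else 0)) =
      (-1) ^ J.card * ((l.factorial * ((A.card.choose J.card : ℂ) / (l.choose J.card : ℂ))) *
        (l.factorial * ((B.card.choose (p - J.card) : ℂ) / (l.choose (p - J.card) : ℂ)))) := by
    intro J _
    rw [← Finset.mul_sum, Fintype.sum_prod_type_right]
    rw [← h1 J A, show p - J.card = (Finset.univ \ J).card by
      rw [Finset.card_sdiff_of_subset (Finset.subset_univ J), Finset.card_univ, Fintype.card_fin],
      ← h1 (Finset.univ \ J) B, Finset.sum_mul_sum]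
  rw [Finset.sum_congr rfl h3, Finset.sum_powerset_apply_card (fun m => (-1 : ℂ) ^ m *
    ((l.factorial * ((A.card.choose m : ℂ) / (l.choose m : ℂ))) *
    (l.factorial * ((B.card.choose (p - m) : ℂ) / (l.choose (p - m) : ℂ))))), Finset.card_univ,
    Fintype.card_fin, Finset.mul_sum]
  refine Finset.sum_congr rfl fun m _ => ?_
  rw [nsmul_eq_mul]
  ring

/-- After the row permutation `(σ, τ)` and the flip, the image of box `(0, j)` is in the first row
iff `σ j ∉ A`, and that of `(1, j)` iff `τ j ∈ A`. Averaging the resulting products gives the sum of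
`zonal_sum_eq_hahn`. -/
theorem rowEval_flipPerm (hp : p ≤ l) (A : Finset (Fin l)) :
    rowEval hp (spechtRep (Fin 2 × Fin l) (twoRow l p hp) (flipPerm A) (sphericalVec hp)) =
      hahn p A.card (-(l : ℂ) - 1) (-(l : ℂ) - 1) l := by
  have h1 : ∀ x : Equiv.Perm (Fin l) × Equiv.Perm (Fin l),
      rowEval hp (spechtRep (Fin 2 × Fin l) (twoRow l p hp) (flipPerm A)
        (spechtRep (Fin 2 × Fin l) (twoRow l p hp) (rowPerm x)
          (columnVec hp (stdEmb hp) (stdEmb_injective hp)))) =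
      ∏ j : Fin p, ((if x.1 (Fin.castLE hp j) ∈ Aᶜ then (1 : ℂ) else 0) -
        (if x.2 (Fin.castLE hp j) ∈ A then (1 : ℂ) else 0)) := by
    intro x
    rw [spechtRep_columnVec, spechtRep_columnVec, rowEval_columnVec]
    refine Finset.prod_congr rfl fun j _ => ?_
    have e0 : (rowPerm x : Equiv.Perm (Fin 2 × Fin l)) (stdEmb hp (0, j)) =
      (0, x.1 (Fin.castLE hp j)) := rfl
    have e1 : (rowPerm x : Equiv.Perm (Fin 2 × Fin l)) (stdEmb hp (1, j)) =
      (1, x.2 (Fin.castLE hp j)) := rfl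
    simp only [Function.comp_apply, e0, e1, flipPerm_apply, firstRow, Finset.mem_compl]
    by_cases h0 : x.1 (Fin.castLE hp j) ∈ A <;> by_cases h1 : x.2 (Fin.castLE hp j) ∈ A <;>
      simp [h0, h1]
  have hlf : (l.factorial : ℂ) ≠ 0 := by exact_mod_cast l.factorial_ne_zero
  have hA : A.card ≤ l := by simpa using Finset.card_le_univ A
  rw [sphericalVec, subgroupAverage_apply, map_smul, map_smul, map_sum, map_sum,
    ← rowPerm_bijective.sum_comp (fun k : rowGroup 2 l => rowEval hp
      (spechtRep (Fin 2 × Fin l) (twoRow l p hp) (flipPerm A)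
        (spechtRep (Fin 2 × Fin l) (twoRow l p hp) k
          (columnVec hp (stdEmb hp) (stdEmb_injective hp))))),
    Finset.sum_congr rfl fun x _ => h1 x, sum_perm_prod_sub, card_rowGroup, smul_eq_mul,
    inv_mul_cancel_left₀ (mul_ne_zero hlf hlf), ← zonal_sum_eq_hahn l p _ hp]
  refine Finset.sum_congr rfl fun j hj => ?_
  rw [Finset.mem_range] at hj
  rw [poch_neg_div_poch_neg (show j ≤ l by omega), show ((A.card : ℂ) - l) =
    -((l - A.card : ℕ) : ℂ) by push_cast [hA]; ring,
    poch_neg_div_poch_neg (show p - j ≤ l by omega), Finset.card_compl, Fintype.card_fin]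

theorem zonal_gPerm (hp : p ≤ l) {s : ℕ} (hs : s ≤ l) :
    zonal 2 l (twoRow l p hp) (gPerm l s) = hahn p s (-(l : ℂ) - 1) (-(l : ℂ) - 1) l := by
  rw [zonal_eq, gPerm_eq, rowEval_flipPerm, card_filter_lt hs]

/-! ### The column group -/

theorem flipPerm_mem (A : Finset (Fin l)) : flipPerm A ∈ colGroup 2 l := by
  rw [mem_colGroup]
  intro x
  rw [flipPerm_apply]
  split_ifs <;> rfl

theorem flipPerm_bijective :
    Function.Bijective fun A : Finset (Fin l) => (⟨flipPerm A, flipPerm_mem A⟩ : colGroup 2 l) := by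
  constructor
  · intro A B h
    have h' := congrArg Subtype.val h
    ext j
    have := congrArg Prod.fst (Equiv.congr_fun h' (0, j))
    simp only [flipPerm_apply] at this
    by_cases h1 : j ∈ A <;> by_cases h2 : j ∈ B <;> simp_all
  · rintro ⟨h, hh⟩
    rw [mem_colGroup] at hh
    -- The flipped columns are those whose top box is sent to the bottom row.
    refine ⟨Finset.univ.filter fun j => (h (0, j)).1 = 1, Subtype.ext (Equiv.ext ?_)⟩
    rintro ⟨i, j⟩
    have hne : (h (0, j)).1 ≠ (h (1, j)).1 := fun h' => by
      have := h.injective (Prod.ext h' (by rw [hh, hh]))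
      simp at this
    refine Prod.ext ?_ ?_
    · simp only [flipPerm_apply, Finset.mem_filter, Finset.mem_univ, true_and]
      by_cases h1 : (h (0, j)).1 = 1
      · rw [if_pos h1]
        fin_cases i
        · exact h1.symm
        · simp only [Fin.mk_one] at hne ⊢
          change (0 : Fin 2) = _
          omega
      · rw [if_neg h1]
        fin_cases i
        · simp only [Fin.zero_eta]
          omega
        · simp only [Fin.mk_one]
          omega
    · rw [hh, (mem_colGroup.1 (flipPerm_mem _))]

/-- The flip is an involution moving `2 |A|` boxes, hence a product of `|A|` disjoint
transpositions. -/
theorem nu_flipPerm (A : Finset (Fin l)) : nu (flipPerm A) = A.card := by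
  have hsupp : (flipPerm A).support = Finset.univ ×ˢ A := by
    ext ⟨i, j⟩
    rw [Equiv.Perm.mem_support, flipPerm_apply]
    by_cases h : j ∈ A
    · fin_cases i <;> simp [h]
    · simp [h]
  have hord : orderOf (flipPerm A) ∣ 2 := by
    rw [orderOf_dvd_iff_pow_eq_one, pow_two]
    nth_rewrite 1 [← flipPerm_inv]
    exact inv_mul_cancel _
  have hct : ∀ n ∈ (flipPerm A).cycleType, n = 2 := fun n hn =>
    le_antisymm (Nat.le_of_dvd two_pos ((Equiv.Perm.dvd_of_mem_cycleType hn).trans hord))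
      (Equiv.Perm.two_le_of_mem_cycleType hn)
  have hsum := Equiv.Perm.sum_cycleType (flipPerm A)
  rw [hsupp, Finset.card_product, Finset.card_univ, Fintype.card_fin,
    Multiset.eq_replicate_card.2 hct, Multiset.sum_replicate] at hsum
  rw [nu, Multiset.eq_replicate_card.2 hct, Multiset.map_replicate, Multiset.sum_replicate]
  simp only [smul_eq_mul] at hsum ⊢
  omega

/-! ### Unitary models -/

variable {W : Type*} [NormedAddCommGroup W] [InnerProductSpace ℂ W]
  {ρ : Representation ℂ (Equiv.Perm (Fin 2 × Fin l)) W}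

theorem map_rowInvariants {μ : YoungDiagram} (φ : SpechtModule (Fin 2 × Fin l) μ ≃ₗ[ℂ] W)
    (hφ : ∀ g v, φ (spechtRep (Fin 2 × Fin l) μ g v) = ρ g (φ v)) :
    (rowInvariants (spechtRep (Fin 2 × Fin l) μ)).map (φ : SpechtModule (Fin 2 × Fin l) μ →ₗ[ℂ] W) =
      rowInvariants ρ := by
  ext w
  rw [Submodule.mem_map]
  constructor
  · rintro ⟨v, hv, rfl⟩ k
    have h := congrArg φ (hv k)
    rwa [MonoidHom.comp_apply, hφ] at h
  · intro hw
    refine ⟨φ.symm w, fun k => ?_, by simp⟩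
    apply φ.injective
    rw [MonoidHom.comp_apply, hφ, φ.apply_symm_apply]
    exact hw k

theorem finrank_rowInvariants_of_isUnitaryModel (hp : p ≤ l)
    (h : IsUnitaryModel (twoRow l p hp) ρ) : Module.finrank ℂ (rowInvariants ρ) = 1 := by
  obtain ⟨φ, hφ⟩ := h.exists_equiv
  rw [← map_rowInvariants φ hφ, LinearEquiv.finrank_map_eq, finrank_rowInvariants]

/-- By unitarity and invariance of `w`, `ρ g w` may be averaged over the row group inside the inner
product. The average is the zonal value times `w`, by transport of `average_eq`; the linear
isomorphism need not be isometric. -/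
theorem inner_apply_of_isUnitaryModel (hp : p ≤ l) (h : IsUnitaryModel (twoRow l p hp) ρ)
    {w : W} (hw : w ∈ rowInvariants ρ) (g : Equiv.Perm (Fin 2 × Fin l)) :
    inner ℂ w (ρ g w) =
      rowEval hp (spechtRep (Fin 2 × Fin l) (twoRow l p hp) g (sphericalVec hp)) *
        inner ℂ w w := by
  obtain ⟨φ, hφ⟩ := h.exists_equiv
  have havg : ∀ v, φ (subgroupAverage (spechtRep (Fin 2 × Fin l) (twoRow l p hp)) (rowGroup 2 l) v)
      = subgroupAverage ρ (rowGroup 2 l) (φ v) := by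
    intro v
    simp only [subgroupAverage_apply, map_smul, map_sum, hφ]
  have hinner : inner ℂ w (subgroupAverage ρ (rowGroup 2 l) (ρ g w)) = inner ℂ w (ρ g w) := by
    have hk : ∀ k : rowGroup 2 l, inner ℂ w (ρ k (ρ g w)) = inner ℂ w (ρ g w) := by
      intro k
      have hwk : ρ k w = w := hw k
      -- Invariance puts `ρ k` into the left slot as well, where unitarity cancels it.
      conv_lhs => rw [← hwk]
      conv_lhs => rw [hwk, ← hwk, h.inner_map, hwk]
    rw [subgroupAverage_apply, inner_smul_right, inner_sum, Finset.sum_congr rfl fun k _ => hk k]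
    simp only [Finset.sum_const, Finset.card_univ]
    rw [nsmul_eq_mul, ← mul_assoc, inv_mul_cancel₀ (card_subgroup_ne_zero _), one_mul]
  rw [← hinner]
  rw [← map_rowInvariants φ hφ] at hw
  obtain ⟨v, hv, rfl⟩ := hw
  have hv' := (mem_invariants_iff_eq_smul (average_eq hp)).1 hv
  have : subgroupAverage ρ (rowGroup 2 l) (ρ g (φ v)) = rowEval hp (spechtRep (Fin 2 × Fin l)
      (twoRow l p hp) g (sphericalVec hp)) • φ v := by
    rw [← hφ, ← havg, average_eq]
    conv_lhs => rw [hv']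
    conv_rhs => rw [hv']
    simp only [map_smul, smul_eq_mul, smul_smul]
    rw [mul_comm]
  rw [LinearEquiv.coe_coe, this, inner_smul_right]

/-- Flips are their own inverses, so the inverse in the right action disappears; grouping the sets
`A` by size produces the binomial coefficients. -/
theorem transitionMatrix_eq (hp : p ≤ l) (h : IsUnitaryModel (twoRow l p hp) ρ) {d : ℕ}
    (e : OrthonormalBasis (Fin d) ℂ (rowInvariants ρ)) :
    d = 1 ∧ ∀ (α : ℂ) (i j : Fin d), transitionMatrix ρ e α i j =
      ∑ s ∈ Finset.range (l + 1),
        (l.choose s : ℂ) * hahn p s (-(l : ℂ) - 1) (-(l : ℂ) - 1) l * α ^ s := by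
  have hd : d = 1 := by
    rw [← finrank_rowInvariants_of_isUnitaryModel hp h,
      Module.finrank_eq_card_basis e.toBasis, Fintype.card_fin]
  refine ⟨hd, fun α i j => ?_⟩
  subst hd
  obtain rfl := Subsingleton.elim i j
  have hunit : inner ℂ (e i : W) (e i : W) = 1 := by
    rw [← Submodule.coe_inner, inner_self_eq_norm_sq_to_K, e.orthonormal.1 i]
    simp
  rw [transitionMatrix, Matrix.of_apply, ← flipPerm_bijective.sum_comp]
  have hterm : ∀ A : Finset (Fin l), α ^ nu (flipPerm A) * psi ρ e i i (flipPerm A) =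
      α ^ A.card * hahn p A.card (-(l : ℂ) - 1) (-(l : ℂ) - 1) l := by
    intro A
    rw [nu_flipPerm, psi, flipPerm_inv, inner_apply_of_isUnitaryModel hp h (e i).2, hunit,
      rowEval_flipPerm, mul_one]
  rw [Finset.sum_congr rfl fun A _ => hterm A, ← Finset.powerset_univ,
    Finset.sum_powerset_apply_card (fun s => α ^ s * hahn p s (-(l : ℂ) - 1) (-(l : ℂ) - 1) l),
    Finset.card_univ, Fintype.card_fin]
  refine Finset.sum_congr rfl fun s _ => ?_
  rw [nsmul_eq_mul]
  ring

end ZonalValues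

end AlphaDet

end

theorem theorem3p1 (l : ℕ) (hl : 0 < l) :
    (∀ (p : ℕ) (hp : p ≤ l),
      -- the space of `K`-invariants in `S^λ`, `λ = (2l - p, p)`, is one-dimensional
      Module.finrank ℂ (AlphaDet.rowInvariants
        (AlphaDet.spechtRep (Fin 2 × Fin l) (AlphaDet.twoRow l p hp))) = 1 ∧
      -- the values of the zonal spherical function are values of a Hahn polynomial
      (∀ s ≤ l, AlphaDet.zonal 2 l (AlphaDet.twoRow l p hp) (AlphaDet.gPerm l s) =
        AlphaDet.hahn p s (-(l : ℂ) - 1) (-(l : ℂ) - 1) l) ∧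
      -- the transition matrix, for every choice of the unitary module and the orthonormal basis
      (∀ (W : Type*) [NormedAddCommGroup W] [InnerProductSpace ℂ W]
        (ρ : Representation ℂ (Equiv.Perm (Fin 2 × Fin l)) W),
        AlphaDet.IsUnitaryModel (AlphaDet.twoRow l p hp) ρ →
        ∀ (d : ℕ) (e : OrthonormalBasis (Fin d) ℂ (AlphaDet.rowInvariants ρ)),
          d = 1 ∧ ∀ (α : ℂ) (i j : Fin d), AlphaDet.transitionMatrix ρ e α i j =
            ∑ s ∈ Finset.range (l + 1),
              (l.choose s : ℂ) * AlphaDet.hahn p s (-(l : ℂ) - 1) (-(l : ℂ) - 1) l * α ^ s) ∧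
      -- the closed form
      (∀ α : ℂ, ∑ s ∈ Finset.range (l + 1),
          (l.choose s : ℂ) * AlphaDet.hahn p s (-(l : ℂ) - 1) (-(l : ℂ) - 1) l * α ^ s =
        (1 + α) ^ (l - p) * AlphaDet.G l p α) ∧
      -- `G_p^l` is a Jacobi polynomial up to a nonzero constant
      (Ring.choose ((p : ℤ) - l - 1) p ≠ 0 ∧
        ∀ α : ℂ, AlphaDet.G l p α = ((Ring.choose ((p : ℤ) - l - 1) p : ℤ) : ℂ)⁻¹ *
          AlphaDet.jacobi p (-(l : ℂ) - 1) (2 * (l : ℂ) - 2 * p + 1) (1 + 2 * α))) ∧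
    -- the irreducible decomposition of the cyclic module
    (∀ α : ℂ, ∃ N : {s : Fin (l + 1) //
          (1 + α) ^ (l - (s : ℕ)) * AlphaDet.G l s α ≠ 0} → Submodule ℂ (AlphaDet.Poly 2),
      (∀ s, AlphaDet.IsIrredOfHighestWeight (N s)
        ![2 * (l : ℂ) - ((s : Fin (l + 1)) : ℕ), (((s : Fin (l + 1)) : ℕ) : ℂ)]) ∧
      iSupIndep N ∧ ⨆ s, N s = AlphaDet.cyclicModule 2 l α) := by
  refine ⟨fun p hp => ⟨AlphaDet.finrank_rowInvariants hp, fun s hs => AlphaDet.zonal_gPerm hp hs,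
    ?_, AlphaDet.sum_choose_mul_pow l p hp, AlphaDet.G_eq_jacobi l p hp⟩,
    AlphaDet.exists_irreducible_decomposition l⟩
  intro W _ _ ρ h d e
  exact AlphaDet.transitionMatrix_eq hp h e
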